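/- Let $L\ge 4$ be a power of two, let $\mathcal L=\{0,\dots,L\}^2$, and write $N_\rho(A)=\{\vec x\in\mathbb R^2:\lVert\vec x-\vec y\rVert<\rho\text{ for some }\vec y\in A\}$. For $\vec a=(a_1,a_2)\in\{0,\dots,L-1\}^2$, the dissection $D(\vec a)$ is the following 4-ary tree of squares. Its root is $[-a_1-\tfrac12,\,2L-a_1-\tfrac12]\times[-a_2-\tfrac12,\,2L-a_2-\tfrac12]$, and every node of side length more than one has as its children the four equal squares into which it is partitioned. The grid lines of $D(\vec a)$ are the vertical lines through $(-a_1-\tfrac12+k,0)$ and the horizontal lines through $(0,-a_2-\tfrac12+k)$ for $k\in\{1,\dots,2L-1\}$; $G$ denotes their union. A boundary of $D(\vec a)$ is a border edge of a non-root node that is not contained in another border edge of a node of $D(\vec a)$. For a straight line segment $b$ and $k\ge 2$, $\mathrm{grid}(b,k,\delta)$ is the set of $k$ equispaced subsegments of length $\delta$ of $b$ (called portals) such that the two endpoints of $b$ lie in the first and in the last of them, respectively. A curve is the image of a continuous path in $\mathbb R^2$, $l$ denotes Euclidean length, $l(\mathcal S)=\sum_{s\in\mathcal S}l(s)$ for a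 finite family $\mathcal S$ of curves, and $s^\circ$ is the curve $s$ without its two endpoints. Let $\mathcal S=\{s_1,\dots,s_m\}$ be a finite family of straight line segments in the plane, each of which connects two points of $N_{1/4}(\mathcal L)$, and let $\vec a\in\{0,\dots,L-1\}^2$ be chosen uniformly at random. Then for every integer $r\ge 1$, every $\delta\in(0,1)$ and every $\delta'>0$, there is for every $\vec a$ a family $\mathcal S'=\{s_1',\dots,s_m'\}$ of curves of finite length, where $s_i'$ connects the same two endpoints as $s_i$, such that a) $s_i'$ differs from $s_i$ only in $N_{\delta'}(G)$, i.e. $s_i'\setminus N_{\delta'}(G)=s_i\setminus N_{\delta'}(G)$; b) if the $s_i^\circ$ are pairwise disjoint, then the $(s_i')^\circ$ are pairwise disjoint; c) every $s_i'$ intersects every boundary $b$ of $D(\vec a)$ only in the portals $\mathrm{grid}(b,r\log_2 L,\delta)$; d) $g_1\cap g_2\cap s_i'=\emptyset$ for every $i$ and all grid lines $g_1\ne g_2$; e) the curves of $\mathcal S'$ intersect the grid lines in only finitely many points; f) $\mathbb E_{\vec a}\left[l(\mathcal S')-l(\mathcal S)\right]\le 7\sqrt2\cdot\dfrac{l(\mathcal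 S)}{r}$. -/

import Mathlib

open Set
open scoped ENNReal

noncomputable section

namespace PortalSnapping

/-- The Euclidean plane. -/
abbrev Plane : Type := EuclideanSpace ℝ (Fin 2)

/-- The lattice points `{0, …, L}²`. -/
def lattice (L : ℕ) : Set Plane :=
  {z | ∃ i j : ℕ, i ≤ L ∧ j ≤ L ∧ z = !₂[(i : ℝ), (j : ℝ)]}

/-- The axis-parallel square `[x, x + side] × [y, y + side]`. -/
structure Square where
  x : ℝ
  y : ℝ
  side : ℝ

/-- The four equal sized squares into which a square is partitioned. -/
def Square.children (S : Square) : Set Square :=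
  {⟨S.x, S.y, S.side / 2⟩,
   ⟨S.x + S.side / 2, S.y, S.side / 2⟩,
   ⟨S.x, S.y + S.side / 2, S.side / 2⟩,
   ⟨S.x + S.side / 2, S.y + S.side / 2, S.side / 2⟩}

/-- The four border edges (bottom, top, left, right), each given by its pair of endpoints. -/
def Square.borderEdges (S : Square) : Set (Plane × Plane) :=
  {(!₂[S.x, S.y], !₂[S.x + S.side, S.y]),
   (!₂[S.x, S.y + S.side], !₂[S.x + S.side, S.y + S.side]),
   (!₂[S.x, S.y], !₂[S.x, S.y + S.side]),
   (!₂[S.x + S.side, S.y], !₂[S.x + S.side, S.y + S.side])}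

/-- The root square `C(a) = [-a₁ - 1/2, 2L - a₁ - 1/2] × [-a₂ - 1/2, 2L - a₂ - 1/2]`. -/
def rootSquare {L : ℕ} (a : Fin L × Fin L) : Square :=
  ⟨-(a.1 : ℝ) - 1 / 2, -(a.2 : ℝ) - 1 / 2, 2 * L⟩

/-- The nodes of the dissection `D(a)`: the root is `C(a)`, and every node of side length more
than one has its four quarter squares as children. -/
inductive IsNode {L : ℕ} (a : Fin L × Fin L) : Square → Prop
  | root : IsNode a (rootSquare a)
  | child {S T : Square} (hS : IsNode a S) (hside : 1 < S.side) (hT : T ∈ S.children) :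
      IsNode a T

/-- A boundary of `D(a)`: a border edge of a non-root node that is not contained in another
border edge (of any node, the root included). -/
def IsBoundary {L : ℕ} (a : Fin L × Fin L) (b : Plane × Plane) : Prop :=
  (∃ S : Square, IsNode a S ∧ S ≠ rootSquare a ∧ b ∈ S.borderEdges) ∧
  ∀ T : Square, IsNode a T → ∀ e ∈ T.borderEdges,
    segment ℝ b.1 b.2 ⊆ segment ℝ e.1 e.2 → segment ℝ e.1 e.2 = segment ℝ b.1 b.2

/-- The grid lines of `D(a)`: the vertical lines through `(-a₁ - 1/2 + k, 0)` and the horizontal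
lines through `(0, -a₂ - 1/2 + k)`, for `k = 1, …, 2L - 1`. -/
def gridLines {L : ℕ} (a : Fin L × Fin L) : Set (Set Plane) :=
  {g | ∃ k : ℕ, 1 ≤ k ∧ k < 2 * L ∧
    (g = {z : Plane | z 0 = -(a.1 : ℝ) - 1 / 2 + k} ∨
     g = {z : Plane | z 1 = -(a.2 : ℝ) - 1 / 2 + k})}

/-- The union of all grid lines of `D(a)`. -/
def gridUnion {L : ℕ} (a : Fin L × Fin L) : Set Plane := ⋃₀ gridLines a

/-- The point of the segment from `b.1` to `b.2` at distance `t` from `b.1`. -/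
def pointAt (b : Plane × Plane) (t : ℝ) : Plane :=
  AffineMap.lineMap b.1 b.2 (t / dist b.1 b.2)

/-- The set covered by `grid(b, k, δ)`, for `k ≥ 2`: `k` equispaced subsegments of length `δ` of
the segment `b`, of which the first starts at one endpoint of `b` and the last ends at the
other. -/
def portals (b : Plane × Plane) (k : ℕ) (δ : ℝ) : Set Plane :=
  {z | ∃ j : ℕ, j < k ∧
    z ∈ segment ℝ (pointAt b (j * ((dist b.1 b.2 - δ) / ((k : ℝ) - 1))))
      (pointAt b (j * ((dist b.1 b.2 - δ) / ((k : ℝ) - 1)) + δ))}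

/-- The Euclidean length of a curve. -/
def curveLength {p q : Plane} (γ : Path p q) : ℝ≥0∞ := eVariationOn γ univ

end PortalSnapping

end

open PortalSnapping

/-!
Every crossing of a segment with a grid line is slid along that line into the nearest portal. On a
fixed line the slide is a strictly increasing map which never passes an endpoint of a boundary, so
distinct crossings stay distinct and in order; if the slide is spread over an `ε`-neighbourhood of
the line by a tent function, then for small `ε` disjoint segments stay disjoint.

A common point of two perpendicular grid lines is an endpoint of boundaries on the line with the
longer boundaries (on the vertical line, in case of a tie), which is said to own it. A segment
through it is slid along the owner only, so it crosses the other line near the common point, off all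
further grid lines and, if an end of a boundary lies there, within the first or the last portal.

The line with index `n` carries boundaries of length `gcd(n, L)`, so that sliding a crossing with it
costs at most `gcd(n, L) / M + 2θ`, where `M + 1` is the number of portals of a boundary and `θ` can
be taken as small as we like. For random `a`, the average of `gcd(c + a, L)` is `(log₂ L + 2) / 2`,
and a segment of length `l` crosses at most `2√2 l` lines.
-/

namespace PortalSnapping

section PortalSnap

/-- The index of the portal nearest to `v` among `M + 1` equispaced portals, numbered from `0`, of
the interval `[c * N, (c + 1) * N)` that contains `v`. -/
noncomputable def portalIndex (N : ℝ) (M : ℕ) (v : ℝ) : ℤ := round (M * Int.fract (v / N))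

/-- The position, relative to the length of a portal, at which `portalSnap` enters the portal. It
increases with `v`, which keeps apart the points that are sent to the same portal, and it is never
a multiple of `1 / M`. -/
noncomputable def portalOffset (N : ℝ) (M : ℕ) (v : ℝ) : ℝ := (Int.fract (v / N) + 1) / (3 * M)

/-- The map that moves every real into the nearest portal, where each interval
`[c * N, (c + 1) * N]` carries `M + 1` equispaced portals of length `θ`, the first and the last one
at its ends. -/
noncomputable def portalSnap (N : ℝ) (M : ℕ) (θ v : ℝ) : ℝ :=
  N * ⌊v / N⌋ + (N - θ) * (portalIndex N M v / M) + θ * portalOffset N M v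

lemma monotone_round {α : Type*} [Field α] [LinearOrder α] [IsStrictOrderedRing α] [FloorRing α] :
    Monotone (round : α → ℤ) := fun x y h => by
  rw [round_eq, round_eq]
  exact Int.floor_mono (by gcongr)

variable {N θ δ v : ℝ} {M : ℕ}

lemma portalIndex_mem_Icc : portalIndex N M v ∈ Icc (0 : ℤ) M := by
  constructor
  · have h : round (0 : ℝ) ≤ portalIndex N M v :=
      monotone_round (mul_nonneg M.cast_nonneg (Int.fract_nonneg _))
    rwa [round_zero] at h
  · have h : portalIndex N M v ≤ round (M : ℝ) :=
      monotone_round (mul_le_of_le_one_right M.cast_nonneg (Int.fract_lt_one _).le)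
    rwa [round_natCast] at h

lemma portalIndex_div_mem_Icc : (portalIndex N M v : ℝ) / M ∈ Icc (0 : ℝ) 1 := by
  obtain ⟨h0, hM⟩ := portalIndex_mem_Icc (N := N) (M := M) (v := v)
  exact ⟨div_nonneg (mod_cast h0) M.cast_nonneg, div_le_one_of_le₀ (mod_cast hM) M.cast_nonneg⟩

lemma mul_portalOffset_mem_Ioo (hM : 0 < M) : M * portalOffset N M v ∈ Ioo (0 : ℝ) 1 := by
  have h0 := Int.fract_nonneg (v / N)
  have h1 := Int.fract_lt_one (v / N)
  have h : M * portalOffset N M v = (Int.fract (v / N) + 1) / 3 := by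
    unfold portalOffset
    field_simp
  rw [h]
  constructor <;> linarith

lemma portalOffset_mem_Ioo (hM : 0 < M) : portalOffset N M v ∈ Ioo (0 : ℝ) 1 := by
  obtain ⟨h0, h1⟩ := mul_portalOffset_mem_Ioo (N := N) (v := v) hM
  have hM' : (1 : ℝ) ≤ M := mod_cast hM
  have hpos := pos_of_mul_pos_right h0 (zero_le_one.trans hM')
  exact ⟨hpos, (le_mul_of_one_le_left hpos.le hM').trans_lt h1⟩

lemma abs_portalOffset_sub_le (hM : 0 < M) :
    |portalOffset N M v - portalIndex N M v / M| ≤ 1 := by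
  obtain ⟨h0, h1⟩ := portalIndex_div_mem_Icc (N := N) (M := M) (v := v)
  obtain ⟨h2, h3⟩ := portalOffset_mem_Ioo (N := N) (v := v) hM
  rw [abs_le]
  constructor <;> linarith

lemma mul_floor_add_mul_fract (hN : N ≠ 0) (v : ℝ) :
    N * ⌊v / N⌋ + N * Int.fract (v / N) = v := by
  rw [← mul_add, Int.floor_add_fract, mul_div_cancel₀ v hN]

lemma portalSnap_mem_Ioo (hM : 0 < M) (hθ : 0 < θ) (hθN : θ ≤ N) :
    portalSnap N M θ v ∈ Ioo (N * ⌊v / N⌋) (N * (⌊v / N⌋ + 1)) := by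
  obtain ⟨h0, h1⟩ := portalIndex_div_mem_Icc (N := N) (M := M) (v := v)
  obtain ⟨h2, h3⟩ := portalOffset_mem_Ioo (N := N) (v := v) hM
  unfold portalSnap
  constructor <;> nlinarith

lemma portalSnap_strictMono (hM : 0 < M) (hθ : 0 < θ) (hθN : θ ≤ N) :
    StrictMono (portalSnap N M θ) := by
  intro v w hvw
  have hN : 0 < N := hθ.trans_le hθN
  have hlt : v / N < w / N := by gcongr
  rcases (Int.floor_mono hlt.le).lt_or_eq with hfloor | hfloor
  · have hmul : N * (⌊v / N⌋ + 1) ≤ N * ⌊w / N⌋ := by gcongr; exact_mod_cast hfloor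
    exact ((portalSnap_mem_Ioo hM hθ hθN).2.trans_le hmul).trans (portalSnap_mem_Ioo hM hθ hθN).1
  · have hfract : Int.fract (v / N) < Int.fract (w / N) := by
      unfold Int.fract
      rw [hfloor]
      gcongr
    have hindex : portalIndex N M v ≤ portalIndex N M w := monotone_round (by gcongr)
    have hoffset : portalOffset N M v < portalOffset N M w := by
      unfold portalOffset
      gcongr
    unfold portalSnap
    rw [hfloor]
    refine add_lt_add_of_le_of_lt (add_le_add le_rfl ?_) (by gcongr)
    exact mul_le_mul_of_nonneg_left (by gcongr) (sub_nonneg.2 hθN)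

lemma portalSnap_eq_add_mul_sub :
    portalSnap N M θ v = N * ⌊v / N⌋ + N * (portalIndex N M v / M) +
      θ * (portalOffset N M v - portalIndex N M v / M) := by
  unfold portalSnap
  ring

lemma portalSnap_ne_intCast {n : ℤ} (hM : 0 < M) (hθ : 0 < θ) (hθM : θ * M < 1) (z : ℤ) :
    portalSnap n M θ v ≠ z := by
  intro h
  have hM' : (0 : ℝ) < M := mod_cast hM
  rw [portalSnap_eq_add_mul_sub] at h
  have habs := abs_portalOffset_sub_le (N := n) (v := v) hM
  obtain ⟨hpos, hlt⟩ := mul_portalOffset_mem_Ioo (N := n) (v := v) hM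
  generalize portalOffset (n : ℝ) M v = o at *
  generalize portalIndex (n : ℝ) M v = j at *
  have hint : θ * M * (o - j / M) = ((M * (z - n * ⌊v / n⌋) - n * j : ℤ) : ℝ) := by
    push_cast
    field_simp at h ⊢
    linarith
  have hzero : (M * (z - n * ⌊v / n⌋) - n * j : ℤ) = 0 := by
    rw [← Int.abs_lt_one_iff]
    have : |θ * M * (o - j / M)| < 1 := by
      rw [abs_mul, abs_of_pos (by positivity)]
      exact (mul_le_of_le_one_right (by positivity) habs).trans_lt hθM
    rw [hint] at this
    exact_mod_cast this
  rw [hzero, Int.cast_zero, mul_eq_zero, sub_eq_zero] at hint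
  have hj : (M : ℝ) * o = j := by
    rw [hint.resolve_left (by positivity), mul_div_cancel₀ _ hM'.ne']
  rw [hj] at hpos hlt
  norm_cast at hpos hlt
  omega

lemma abs_portalSnap_sub_le (hN : 0 < N) (hM : 0 < M) (hθ : 0 ≤ θ) :
    |portalSnap N M θ v - v| ≤ N / (2 * M) + θ := by
  have hM' : (0 : ℝ) < M := mod_cast hM
  have hsub : portalSnap N M θ v - v = N / M * (portalIndex N M v - M * Int.fract (v / N)) +
      θ * (portalOffset N M v - portalIndex N M v / M) := by
    rw [portalSnap_eq_add_mul_sub]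
    nth_rewrite 5 [← mul_floor_add_mul_fract hN.ne' v]
    field_simp
    ring
  have hround : |portalIndex N M v - M * Int.fract (v / N)| ≤ 1 / 2 := by
    rw [abs_sub_comm]
    exact abs_sub_round _
  calc |portalSnap N M θ v - v|
      ≤ N / M * |portalIndex N M v - M * Int.fract (v / N)| +
          θ * |portalOffset N M v - portalIndex N M v / M| := by
        rw [hsub]
        refine (abs_add_le _ _).trans_eq ?_
        rw [abs_mul, abs_mul, abs_of_pos (div_pos hN hM'), abs_of_nonneg hθ]
    _ ≤ N / M * (1 / 2) + θ * 1 := by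
        gcongr
        exact abs_portalOffset_sub_le hM
    _ = N / (2 * M) + θ := by field_simp

lemma exists_portal_of_portalSnap_mem_Icc (hM : 0 < M) (hθ : 0 < θ) (hθN : θ ≤ N) (hθδ : θ ≤ δ)
    {c : ℤ} (h : portalSnap N M θ v ∈ Icc (N * c) (N * (c + 1))) :
    ∃ j : ℕ, j ≤ M ∧
      portalSnap N M θ v - N * c ∈ Icc (j * ((N - δ) / M)) (j * ((N - δ) / M) + δ) := by
  have hN : 0 < N := hθ.trans_le hθN
  obtain ⟨hlow, hhigh⟩ := portalSnap_mem_Ioo (v := v) hM hθ hθN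
  obtain rfl : c = ⌊v / N⌋ := by
    have h1 : (c : ℝ) < ⌊v / N⌋ + 1 := lt_of_mul_lt_mul_left (h.1.trans_lt hhigh) hN.le
    have h2 : (⌊v / N⌋ : ℝ) < c + 1 := lt_of_mul_lt_mul_left (hlow.trans_le h.2) hN.le
    norm_cast at h1 h2
    omega
  obtain ⟨hj0, hjM⟩ := portalIndex_mem_Icc (N := N) (M := M) (v := v)
  obtain ⟨h0, h1⟩ := portalIndex_div_mem_Icc (N := N) (M := M) (v := v)
  obtain ⟨h2, h3⟩ := portalOffset_mem_Ioo (N := N) (v := v) hM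
  refine ⟨(portalIndex N M v).toNat, by omega, ?_⟩
  have hcast : ((portalIndex N M v).toNat : ℝ) = portalIndex N M v := by
    exact_mod_cast Int.toNat_of_nonneg hj0
  rw [hcast, portalSnap, ← mul_div_assoc, mul_comm, mul_div_assoc]
  constructor <;> nlinarith

lemma eq_of_mul_mem_uIcc_portalSnap (hM : 0 < M) (hθ : 0 < θ) (hθN : θ ≤ N) {c : ℤ}
    (h : N * c ∈ uIcc v (portalSnap N M θ v)) : N * c = v := by
  have hN : 0 < N := hθ.trans_le hθN
  obtain ⟨hlow, hhigh⟩ := portalSnap_mem_Ioo (v := v) hM hθ hθN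
  have hfloor : N * ⌊v / N⌋ ≤ v := by
    have := mul_nonneg hN.le (Int.fract_nonneg (v / N))
    linarith [mul_floor_add_mul_fract hN.ne' v]
  have hv : v < N * (⌊v / N⌋ + 1) := by
    have := mul_lt_mul_of_pos_left (Int.fract_lt_one (v / N)) hN
    linarith [mul_floor_add_mul_fract hN.ne' v]
  obtain ⟨h1, h2⟩ := h
  have hc : (c : ℝ) < ⌊v / N⌋ + 1 := lt_of_mul_lt_mul_left (h2.trans_lt (max_lt hv hhigh)) hN.le
  have hc' : (⌊v / N⌋ : ℝ) ≤ c :=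
    le_of_mul_le_mul_left ((le_min hfloor hlow.le).trans h1) hN
  obtain rfl : c = ⌊v / N⌋ := by
    norm_cast at hc hc'
    omega
  refine hfloor.antisymm (not_lt.1 fun hlt => ?_)
  exact absurd h1 (not_le.2 (lt_min hlt hlow))

end PortalSnap

section BoundaryLength

/-- The length of the boundaries that lie on the `n`-th grid line of a direction, where the lines
are numbered from the side of the root square. -/
def boundaryLength (L : ℕ) (n : ℤ) : ℕ := Int.gcd n L

/-- The rule that assigns the common point of the `n`-th line with normal direction `k` and the
`m`-th line perpendicular to it to one of the two: it goes to the line with the longer boundaries,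
and to the vertical line if both have the same length. -/
def OwnsCorner (L : ℕ) (k : Fin 2) (n m : ℤ) : Prop :=
  boundaryLength L m < boundaryLength L n ∨ k = 0 ∧ boundaryLength L m = boundaryLength L n

variable {L : ℕ} {k : Fin 2} {n m : ℤ}

lemma boundaryLength_pos (hL : 0 < L) : 0 < boundaryLength L n :=
  Int.gcd_pos_of_ne_zero_right _ (by positivity)

lemma boundaryLength_dvd_of_le (hL : ∃ e : ℕ, L = 2 ^ e)
    (h : boundaryLength L n ≤ boundaryLength L m) : (boundaryLength L n : ℤ) ∣ m := by
  obtain ⟨e, rfl⟩ := hL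
  have hpow : ∀ l, ∃ f, boundaryLength (2 ^ e) l = 2 ^ f := fun l => by
    obtain ⟨f, -, hf⟩ := (Nat.dvd_prime_pow Nat.prime_two).1
      (Int.natCast_dvd_natCast.1 (Int.gcd_dvd_right l ((2 ^ e : ℕ) : ℤ)))
    exact ⟨f, hf⟩
  obtain ⟨f, hf⟩ := hpow n
  obtain ⟨g, hg⟩ := hpow m
  rw [hf, hg] at h
  have hdvd : boundaryLength (2 ^ e) n ∣ boundaryLength (2 ^ e) m := by
    rw [hf, hg]
    exact pow_dvd_pow 2 ((Nat.pow_le_pow_iff_right one_lt_two).1 h)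
  exact (Int.natCast_dvd_natCast.2 hdvd).trans (Int.gcd_dvd_left _ _)

lemma ownsCorner_rev : OwnsCorner L k.rev m n ↔ ¬ OwnsCorner L k n m := by
  have : k.rev = 0 ↔ k ≠ 0 := by revert k; decide
  unfold OwnsCorner
  rw [this]
  by_cases h : k = 0 <;> simp [h] <;> omega

lemma OwnsCorner.boundaryLength_dvd (hL : ∃ e : ℕ, L = 2 ^ e) (h : OwnsCorner L k n m) :
    (boundaryLength L m : ℤ) ∣ n :=
  boundaryLength_dvd_of_le hL (h.elim le_of_lt fun h => h.2.le)

lemma ownsCorner_of_not_dvd (hL : ∃ e : ℕ, L = 2 ^ e) (h : ¬ (boundaryLength L n : ℤ) ∣ m) :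
    OwnsCorner L k n m :=
  Or.inl (not_le.1 fun h' => h (boundaryLength_dvd_of_le hL h'))

lemma sum_range_add_of_periodic {α : Type*} [AddCommMonoid α] {f : ℤ → α} {n : ℕ}
    (hf : Function.Periodic f n) (c : ℤ) :
    ∑ i ∈ Finset.range n, f (c + i) = ∑ i ∈ Finset.range n, f i := by
  have hstep : ∀ c, ∑ i ∈ Finset.range n, f (c + 1 + i) = ∑ i ∈ Finset.range n, f (c + i) := by
    intro c
    cases n with
    | zero => rfl
    | succ n =>
      rw [Finset.sum_range_succ, Finset.sum_range_succ', add_assoc c, add_comm 1 (n : ℤ),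
        ← Nat.cast_succ, hf, Nat.cast_zero, add_zero]
      simp only [Nat.cast_succ, add_right_comm c 1, add_assoc]
  induction c using Int.induction_on with
  | zero => simp only [zero_add]
  | succ c ih => rw [hstep, ih]
  | pred c ih => rw [← ih, ← hstep, sub_add_cancel]

lemma two_mul_sum_range_gcd_two_pow (e : ℕ) :
    2 * ∑ m ∈ Finset.range (2 ^ e), Nat.gcd m (2 ^ e) = 2 ^ e * (e + 2) := by
  induction e with
  | zero => rfl
  | succ e ih =>
    have hpairs : ∀ K : ℕ, ∑ m ∈ Finset.range (2 * K), Nat.gcd m (2 ^ (e + 1)) =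
        ∑ m ∈ Finset.range K, (2 * Nat.gcd m (2 ^ e) + 1) := by
      intro K
      induction K with
      | zero => rfl
      | succ K ihK =>
        have heven : Nat.gcd (2 * K) (2 ^ (e + 1)) = 2 * Nat.gcd K (2 ^ e) := by
          rw [pow_succ', Nat.gcd_mul_left]
        have hodd : Nat.gcd (2 * K + 1) (2 ^ (e + 1)) = 1 :=
          Nat.Coprime.pow_right (e + 1) (by simp : Nat.Coprime (2 * K + 1) 2)
        rw [mul_add, mul_one, Finset.sum_range_succ, Finset.sum_range_succ, ihK, heven, hodd,
          Finset.sum_range_succ, add_assoc]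
    have hsum := hpairs (2 ^ e)
    rw [← pow_succ'] at hsum
    rw [hsum, Finset.sum_add_distrib, ← Finset.mul_sum, mul_add, ih, Finset.sum_const,
      Finset.card_range, smul_eq_mul]
    ring

lemma two_mul_sum_boundaryLength_add (e : ℕ) (c : ℤ) :
    2 * ∑ a : Fin (2 ^ e), (boundaryLength (2 ^ e) (c + a) : ℝ) = 2 ^ e * (e + 2) := by
  have hperiodic : Function.Periodic (boundaryLength (2 ^ e)) (2 ^ e : ℕ) := fun n =>
    Int.gcd_add_right_left_of_dvd n dvd_rfl
  have hsum := sum_range_add_of_periodic hperiodic c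
  rw [Finset.sum_range] at hsum
  have : 2 * ∑ a : Fin (2 ^ e), boundaryLength (2 ^ e) (c + a) = 2 ^ e * (e + 2) := by
    rw [hsum, ← two_mul_sum_range_gcd_two_pow]
    rfl
  exact_mod_cast this

end BoundaryLength

section Dissection

/-- The lower left corner of the root square of `D(a)`. -/
noncomputable def corner {L : ℕ} (a : Fin L × Fin L) : Fin 2 → ℝ :=
  ![-(a.1 : ℝ) - 1 / 2, -(a.2 : ℝ) - 1 / 2]

/-- The lower left corner of a square. -/
def Square.lowerLeft (S : Square) : Fin 2 → ℝ := ![S.x, S.y]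

/-- The square of side `2 ^ f` in column `p 0` and row `p 1` of the subdivision of the root square
of `D(a)` into squares of this size. -/
noncomputable def dyadicSquare {L : ℕ} (a : Fin L × Fin L) (f : ℕ) (p : Fin 2 → ℕ) : Square :=
  ⟨corner a 0 + 2 ^ f * p 0, corner a 1 + 2 ^ f * p 1, 2 ^ f⟩

/-- The segment `b` lies on the line `z k = u` and reaches from `z k.rev = l` to `z k.rev = r`. -/
structure IsAxisSegment (b : Plane × Plane) (k : Fin 2) (u l r : ℝ) : Prop where
  fst : b.1 k = u
  snd : b.2 k = u
  fst_rev : b.1 k.rev = l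
  snd_rev : b.2 k.rev = r

variable {L e f g n c : ℕ} {a : Fin L × Fin L} {b : Plane × Plane} {k : Fin 2} {u l r : ℝ}

lemma eq_or_eq_rev (k l : Fin 2) : l = k ∨ l = k.rev := by revert k l; decide

lemma rev_ne (k : Fin 2) : k.rev ≠ k := by revert k; decide

lemma plane_ext {z w : Plane} (k : Fin 2) (h : z k = w k) (h' : z k.rev = w k.rev) : z = w := by
  ext l
  rcases eq_or_eq_rev k l with rfl | rfl <;> assumption

lemma lowerLeft_dyadicSquare (p : Fin 2 → ℕ) :
    (dyadicSquare a f p).lowerLeft k = corner a k + 2 ^ f * p k := by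
  fin_cases k <;> rfl

lemma rootSquare_eq_dyadicSquare (hL : L = 2 ^ e) : rootSquare a = dyadicSquare a (e + 1) 0 := by
  simp [rootSquare, dyadicSquare, corner, hL, pow_succ']

lemma mem_children_dyadicSquare_iff {p : Fin 2 → ℕ} {T : Square} :
    T ∈ (dyadicSquare a (f + 1) p).children ↔
      ∃ q : Fin 2 → ℕ, (∀ k, q k / 2 = p k) ∧ T = dyadicSquare a f q := by
  have hhalf : (2 : ℝ) ^ (f + 1) / 2 = 2 ^ f := by rw [pow_succ]; ring
  have heven : ∀ c (m : ℕ), c + (2 : ℝ) ^ (f + 1) * m = c + 2 ^ f * (2 * m : ℕ) := by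
    intro c m; rw [pow_succ]; push_cast; ring
  have hodd : ∀ c (m : ℕ), c + (2 : ℝ) ^ (f + 1) * m + 2 ^ f = c + 2 ^ f * (2 * m + 1 : ℕ) := by
    intro c m; rw [pow_succ]; push_cast; ring
  simp only [Square.children, dyadicSquare, hhalf, hodd, mem_insert_iff, mem_singleton_iff]
  simp only [heven]
  constructor
  · rintro (rfl | rfl | rfl | rfl)
    · exact ⟨![2 * p 0, 2 * p 1], by simp [Fin.forall_fin_two], rfl⟩
    · exact ⟨![2 * p 0 + 1, 2 * p 1], by simp [Fin.forall_fin_two]; omega, rfl⟩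
    · exact ⟨![2 * p 0, 2 * p 1 + 1], by simp [Fin.forall_fin_two]; omega, rfl⟩
    · exact ⟨![2 * p 0 + 1, 2 * p 1 + 1], by simp [Fin.forall_fin_two]; omega, rfl⟩
  · rintro ⟨q, hq, rfl⟩
    have hcases : ∀ k, q k = 2 * p k ∨ q k = 2 * p k + 1 := fun k => by have := hq k; omega
    rcases hcases 0 with h0 | h0 <;> rcases hcases 1 with h1 | h1 <;> simp [h0, h1]

lemma isNode_iff_exists_dyadicSquare (hL : L = 2 ^ e) {S : Square} :
    IsNode a S ↔ ∃ f g, f + g = e + 1 ∧ ∃ p : Fin 2 → ℕ,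
      (∀ k, p k < 2 ^ g) ∧ S = dyadicSquare a f p := by
  constructor
  · intro h
    induction h with
    | root => exact ⟨e + 1, 0, rfl, 0, fun _ => one_pos, rootSquare_eq_dyadicSquare hL⟩
    | child hS hside hT ih =>
      obtain ⟨f, g, hfg, p, hp, rfl⟩ := ih
      cases f with
      | zero => simp [dyadicSquare] at hside
      | succ f =>
        obtain ⟨q, hq, rfl⟩ := mem_children_dyadicSquare_iff.1 hT
        refine ⟨f, g + 1, by omega, q, fun k => ?_, rfl⟩
        have := hp k
        rw [← hq k] at this
        omega
  · rintro ⟨f, g, hfg, p, hp, rfl⟩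
    induction g generalizing f p with
    | zero =>
      obtain rfl : p = 0 := funext fun k => Nat.lt_one_iff.1 (hp k)
      obtain rfl : f = e + 1 := hfg
      exact rootSquare_eq_dyadicSquare (a := a) hL ▸ IsNode.root
    | succ g ih =>
      refine IsNode.child (ih (f + 1) (by omega) (fun k => p k / 2) fun k => ?_)
        (one_lt_pow₀ one_lt_two f.succ_ne_zero) (mem_children_dyadicSquare_iff.2 ⟨p, by simp, rfl⟩)
      have := hp k
      omega

lemma mem_borderEdges_iff {S : Square} : b ∈ S.borderEdges ↔ ∃ k,
    IsAxisSegment b k (S.lowerLeft k) (S.lowerLeft k.rev) (S.lowerLeft k.rev + S.side) ∨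
    IsAxisSegment b k (S.lowerLeft k + S.side) (S.lowerLeft k.rev)
      (S.lowerLeft k.rev + S.side) := by
  obtain ⟨p, q⟩ := b
  have hiff : ∀ k u l r, IsAxisSegment (p, q) k u l r ↔
      p k = u ∧ q k = u ∧ p k.rev = l ∧ q k.rev = r := fun k u l r =>
    ⟨fun h => ⟨h.1, h.2, h.3, h.4⟩, fun ⟨h1, h2, h3, h4⟩ => ⟨h1, h2, h3, h4⟩⟩
  have hext : ∀ (z : Plane) x y, z = !₂[x, y] ↔ z 0 = x ∧ z 1 = y := fun z x y =>
    ⟨fun h => by simp [h], fun h => plane_ext 0 h.1 h.2⟩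
  simp only [Square.borderEdges, mem_insert_iff, mem_singleton_iff, Prod.mk.injEq, hext, hiff,
    Fin.exists_fin_two, Square.lowerLeft, Fin.rev_zero, Fin.reduceLast, Fin.reduceRev,
    Matrix.cons_val_zero, Matrix.cons_val_one]
  tauto

lemma IsAxisSegment.mem_segment_iff (h : IsAxisSegment b k u l r) (hlr : l ≤ r) {z : Plane} :
    z ∈ segment ℝ b.1 b.2 ↔ z k = u ∧ z k.rev ∈ Icc l r := by
  have hcomb : ∀ s t : ℝ, s + t = 1 → s * u + t * u = u := fun s t hst => by
    rw [← add_mul, hst, one_mul]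
  rw [← segment_eq_Icc hlr]
  constructor
  · rintro ⟨s, t, hs, ht, hst, rfl⟩
    simp only [PiLp.add_apply, PiLp.smul_apply, smul_eq_mul, h.fst, h.snd, h.fst_rev, h.snd_rev]
    exact ⟨hcomb s t hst, s, t, hs, ht, hst, rfl⟩
  · rintro ⟨hu, s, t, hs, ht, hst, hz⟩
    refine ⟨s, t, hs, ht, hst, plane_ext k ?_ ?_⟩
    · simp only [PiLp.add_apply, PiLp.smul_apply, smul_eq_mul, h.fst, h.snd, hu, hcomb s t hst]
    · simpa only [PiLp.add_apply, PiLp.smul_apply, smul_eq_mul, h.fst_rev, h.snd_rev] using hz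

lemma IsAxisSegment.segment_subset_iff {b' : Plane × Plane} {l' r' : ℝ}
    (h : IsAxisSegment b k u l r) (h' : IsAxisSegment b' k u l' r') (hlr : l ≤ r) (hlr' : l' ≤ r') :
    segment ℝ b.1 b.2 ⊆ segment ℝ b'.1 b'.2 ↔ l' ≤ l ∧ r ≤ r' := by
  constructor
  · intro hsub
    have hfst := (h'.mem_segment_iff hlr').1 (hsub (left_mem_segment ℝ _ _))
    have hsnd := (h'.mem_segment_iff hlr').1 (hsub (right_mem_segment ℝ _ _))
    rw [h.fst_rev] at hfst
    rw [h.snd_rev] at hsnd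
    exact ⟨hfst.2.1, hsnd.2.2⟩
  · rintro ⟨hl, hr⟩ z hz
    obtain ⟨hzu, hzl, hzr⟩ := (h.mem_segment_iff hlr).1 hz
    exact (h'.mem_segment_iff hlr').2 ⟨hzu, hl.trans hzl, hzr.trans hr⟩

/-- The segment `b` is the `c`-th edge of length `2 ^ f` on the line with normal direction `k` and
distance `2 ^ f * n` from the side of the root square of `D(a)`. -/
def IsDyadicEdge (a : Fin L × Fin L) (b : Plane × Plane) (k : Fin 2) (f n c : ℕ) : Prop :=
  IsAxisSegment b k (corner a k + 2 ^ f * n) (corner a k.rev + 2 ^ f * c)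
    (corner a k.rev + 2 ^ f * (c + 1))

lemma mem_borderEdges_dyadicSquare_iff {p : Fin 2 → ℕ} :
    b ∈ (dyadicSquare a f p).borderEdges ↔ ∃ k,
      IsDyadicEdge a b k f (p k) (p k.rev) ∨ IsDyadicEdge a b k f (p k + 1) (p k.rev) := by
  have hside : (dyadicSquare a f p).side = 2 ^ f := rfl
  simp only [mem_borderEdges_iff, lowerLeft_dyadicSquare, IsDyadicEdge, hside, Nat.cast_add_one,
    mul_add, mul_one, add_assoc]

lemma exists_isAxisSegment (k : Fin 2) (u l r : ℝ) : ∃ b, IsAxisSegment b k u l r := by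
  match k with
  | 0 => exact ⟨(!₂[u, l], !₂[u, r]), by constructor <;> simp⟩
  | 1 => exact ⟨(!₂[l, u], !₂[r, u]), by constructor <;> simp⟩

lemma IsDyadicEdge.exists_isNode (hL : L = 2 ^ e) (hfg : f + g = e + 1) (hn : n ≤ 2 ^ g)
    (hc : c < 2 ^ g) (h : IsDyadicEdge a b k f n c) : ∃ T, IsNode a T ∧ b ∈ T.borderEdges := by
  have hnode : ∀ m < 2 ^ g, IsNode a (dyadicSquare a f (Function.update (fun _ => c) k m)) := by
    refine fun m hm => (isNode_iff_exists_dyadicSquare hL).2 ⟨f, g, hfg, _, fun l => ?_, rfl⟩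
    rw [Function.update_apply]
    split_ifs <;> assumption
  rcases hn.lt_or_eq with hn | rfl
  · refine ⟨_, hnode n hn, mem_borderEdges_dyadicSquare_iff.2 ⟨k, Or.inl ?_⟩⟩
    rwa [Function.update_self, Function.update_of_ne (rev_ne k)]
  · refine ⟨_, hnode (2 ^ g - 1) (by simp), mem_borderEdges_dyadicSquare_iff.2 ⟨k, Or.inr ?_⟩⟩
    rwa [Function.update_self, Function.update_of_ne (rev_ne k),
      Nat.sub_add_cancel Nat.one_le_two_pow]

lemma IsDyadicEdge.not_isBoundary (hL : L = 2 ^ e) (hfg : f + 1 + g = e + 1) (hn : n ≤ 2 ^ g)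
    (hc : c < 2 ^ (g + 1)) (h : IsDyadicEdge a b k f (2 * n) c) : ¬ IsBoundary a b := by
  rintro ⟨-, hmax⟩
  obtain ⟨b', hb'⟩ := exists_isAxisSegment k (corner a k + 2 ^ (f + 1) * n)
    (corner a k.rev + 2 ^ (f + 1) * (c / 2 : ℕ)) (corner a k.rev + 2 ^ (f + 1) * ((c / 2 : ℕ) + 1))
  obtain ⟨T, hT, hb'T⟩ := IsDyadicEdge.exists_isNode hL hfg hn (by omega : c / 2 < 2 ^ g) hb'
  have hpow : (0 : ℝ) < 2 ^ f := by positivity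
  have hlow : (2 : ℝ) ^ (f + 1) * (c / 2 : ℕ) ≤ 2 ^ f * c := by
    rw [pow_succ, mul_assoc]
    gcongr
    exact_mod_cast Nat.mul_div_le c 2
  have hhigh : (2 : ℝ) ^ f * (c + 1) ≤ 2 ^ (f + 1) * ((c / 2 : ℕ) + 1) := by
    rw [pow_succ, mul_assoc]
    gcongr
    exact_mod_cast Nat.lt_mul_div_succ c two_pos
  have hline : corner a k + (2 : ℝ) ^ (f + 1) * n = corner a k + 2 ^ f * (2 * n : ℕ) := by
    push_cast
    ring
  rw [hline] at hb'
  have heq := hmax T hT b' hb'T ((h.segment_subset_iff hb' (by linarith) (by linarith)).2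
    ⟨by linarith, by linarith⟩)
  obtain ⟨hfst, hsnd⟩ :=
    (hb'.segment_subset_iff h (by linarith) (by linarith)).1 heq.subset
  have : (2 : ℝ) ^ (f + 1) ≤ 2 ^ f := by linarith
  rw [pow_succ] at this
  linarith

lemma boundaryLength_two_pow_mul (hL : L = 2 ^ e) (hf : f ≤ e) (hn : Odd n) :
    boundaryLength L ((2 ^ f * n : ℕ) : ℤ) = 2 ^ f := by
  obtain ⟨d, rfl⟩ := Nat.exists_eq_add_of_le hf
  rw [hL, boundaryLength, Int.gcd_natCast_natCast, pow_add, Nat.gcd_mul_left,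
    (Nat.coprime_two_right.2 hn).pow_right d, mul_one]

lemma IsBoundary.exists_isAxisSegment (hL : ∃ e : ℕ, L = 2 ^ e) (hb : IsBoundary a b) :
    ∃ k, ∃ n c : ℤ, IsAxisSegment b k (corner a k + n)
      (corner a k.rev + boundaryLength L n * c)
      (corner a k.rev + boundaryLength L n * (c + 1)) := by
  obtain ⟨e, hL⟩ := hL
  obtain ⟨⟨S, hS, hroot, hmem⟩, -⟩ := id hb
  obtain ⟨f, g, hfg, p, hp, rfl⟩ := (isNode_iff_exists_dyadicSquare hL).1 hS
  cases g with
  | zero =>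
    obtain rfl : p = 0 := funext fun k => Nat.lt_one_iff.1 (hp k)
    obtain rfl : f = e + 1 := hfg
    exact absurd (rootSquare_eq_dyadicSquare hL).symm hroot
  | succ g =>
    obtain ⟨k, n, c, hn, hc, hedge⟩ : ∃ k n c, n ≤ 2 ^ (g + 1) ∧ c < 2 ^ (g + 1) ∧
        IsDyadicEdge a b k f n c := by
      obtain ⟨k, h | h⟩ := mem_borderEdges_dyadicSquare_iff.1 hmem
      · exact ⟨k, p k, p k.rev, (hp k).le, hp _, h⟩
      · exact ⟨k, p k + 1, p k.rev, hp k, hp _, h⟩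
    have hodd : Odd n := by
      refine Nat.not_even_iff_odd.1 fun heven => ?_
      obtain ⟨m, rfl⟩ := heven.two_dvd
      exact hedge.not_isBoundary hL (g := g) (by omega) (by omega) hc hb
    refine ⟨k, (2 ^ f * n : ℕ), c, ?_⟩
    rw [boundaryLength_two_pow_mul hL (by omega) hodd]
    push_cast
    exact hedge

end Dissection

section Tent

/-- The function that grows linearly from `-1` to `1` on `[-ε, ε]` and is constant elsewhere. Its
monotonicity yields the total variation of `tent`. -/
noncomputable def clamp (ε u : ℝ) : ℝ := max (-1) (min 1 (u / ε))

/-- The piecewise linear bump of height one supported on `[-ε, ε]`. -/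
noncomputable def tent (ε u : ℝ) : ℝ := 1 - |clamp ε u|

/-- A line of slope `α` crosses a grid line at position `p`, and this crossing is slid to `q`. Then
`slide ε p q α w` is the position of the bent line at signed distance `w` from the grid line. -/
noncomputable def slide (ε p q α w : ℝ) : ℝ := (1 - tent ε w) * p + tent ε w * q + α * w

variable {ε p q p' q' α α' w w' : ℝ}

lemma clamp_mono (hε : 0 ≤ ε) : Monotone (clamp ε) := fun u v h => by
  unfold clamp
  gcongr

lemma abs_clamp_le_one (ε u : ℝ) : |clamp ε u| ≤ 1 :=
  abs_le.2 ⟨le_max_left _ _, max_le (by norm_num) (min_le_left _ _)⟩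

lemma tent_mem_Icc (ε u : ℝ) : tent ε u ∈ Icc (0 : ℝ) 1 :=
  ⟨sub_nonneg.2 (abs_clamp_le_one ε u), sub_le_self 1 (abs_nonneg _)⟩

lemma tent_zero (ε : ℝ) : tent ε 0 = 1 := by simp [tent, clamp]

lemma tent_of_abs_le (hε : 0 < ε) (h : |w| ≤ ε) : tent ε w = 1 - |w| / ε := by
  obtain ⟨hlow, hhigh⟩ := abs_le.1 h
  have hle : w / ε ≤ 1 := (div_le_one hε).2 hhigh
  have hge : -1 ≤ w / ε := by rwa [le_div_iff₀ hε, neg_one_mul]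
  rw [tent, clamp, min_eq_right hle, max_eq_right hge, abs_div, abs_of_pos hε]

lemma tent_of_le_abs (hε : 0 < ε) (h : ε ≤ |w|) : tent ε w = 0 := by
  rw [tent, sub_eq_zero, eq_comm, clamp]
  rcases le_abs.1 h with h | h
  · rw [min_eq_left ((one_le_div hε).2 h), max_eq_right (by norm_num), abs_one]
  · have hle : w / ε ≤ -1 := by rw [div_le_iff₀ hε]; linarith
    rw [min_eq_right (hle.trans (by norm_num)), max_eq_left hle, abs_neg, abs_one]

lemma continuous_tent (ε : ℝ) : Continuous (tent ε) := by
  unfold tent clamp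
  fun_prop

lemma abs_tent_sub_le (ε u v : ℝ) : |tent ε u - tent ε v| ≤ |clamp ε u - clamp ε v| := by
  rw [tent, tent, sub_sub_sub_cancel_left, abs_sub_comm (clamp ε u)]
  exact abs_abs_sub_abs_le_abs_sub _ _

lemma slide_zero (ε p q α : ℝ) : slide ε p q α 0 = q := by
  rw [slide, tent_zero]
  ring

lemma tent_convex_combination {s : Set ℝ} (hs : Convex ℝ s) (hp : p ∈ s) (hq : q ∈ s) (ε w : ℝ) :
    (1 - tent ε w) * p + tent ε w * q ∈ s :=
  hs hp hq (sub_nonneg.2 (tent_mem_Icc ε w).2) (tent_mem_Icc ε w).1 (sub_add_cancel _ _)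

lemma slide_lt_slide {C : ℝ} (hp : 2 * C < p' - p) (hq : 2 * C < q' - q) (hα : |α * w| ≤ C)
    (hα' : |α' * w| ≤ C) : slide ε p q α w < slide ε p' q' α' w := by
  have := tent_convex_combination (convex_Ioi (2 * C)) hp hq ε w
  rw [mem_Ioi] at this
  unfold slide
  linarith [abs_le.1 hα, abs_le.1 hα']

lemma lt_abs_slide_sub {C d z : ℝ} (hz : z ∉ uIcc p q) (hp : d + C < |p - z|)
    (hq : d + C < |q - z|) (hα : |α * w| ≤ C) : d < |slide ε p q α w - z| := by
  obtain ⟨hlow, hhigh⟩ := abs_le.1 hα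
  rcases lt_or_ge z (min p q) with hlt | hge
  · rw [lt_min_iff] at hlt
    rw [abs_of_pos (sub_pos.2 hlt.1), lt_sub_iff_add_lt] at hp
    rw [abs_of_pos (sub_pos.2 hlt.2), lt_sub_iff_add_lt] at hq
    have := tent_convex_combination (convex_Ioi (d + C + z)) hp hq ε w
    rw [mem_Ioi] at this
    refine lt_of_lt_of_le ?_ (le_abs_self _)
    unfold slide
    linarith
  · have hgt : max p q < z := not_le.1 fun h => hz ⟨hge, h⟩
    rw [max_lt_iff] at hgt
    rw [abs_of_neg (sub_neg.2 hgt.1), neg_sub, lt_sub_comm] at hp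
    rw [abs_of_neg (sub_neg.2 hgt.2), neg_sub, lt_sub_comm] at hq
    have := tent_convex_combination (convex_Iio (z - (d + C))) hp hq ε w
    rw [mem_Iio] at this
    refine lt_of_lt_of_le ?_ (neg_le_abs _)
    unfold slide
    linarith

lemma slide_of_sign {σ : ℝ} (hε : 0 < ε) (hw : |w| ≤ ε) (hσ : |w| = σ * w) :
    slide ε p q α w = q + (α * ε - σ * (q - p)) * w / ε := by
  rw [slide, tent_of_abs_le hε hw, hσ]
  field_simp
  ring

lemma eq_of_slide_eq_slide (hε : 0 < ε) (hw : |w| ≤ ε) (hw' : |w'| ≤ ε) (hside : 0 ≤ w ↔ 0 ≤ w')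
    (hne : slide ε p q α w ≠ q) (heq : slide ε p q α w = slide ε p q α w') : w = w' := by
  obtain ⟨σ, hσw, hσw'⟩ : ∃ σ : ℝ, |w| = σ * w ∧ |w'| = σ * w' := by
    by_cases h : 0 ≤ w
    · exact ⟨1, by rw [one_mul, abs_of_nonneg h], by rw [one_mul, abs_of_nonneg (hside.1 h)]⟩
    · exact ⟨-1, by rw [neg_one_mul, abs_of_neg (not_le.1 h)],
        by rw [neg_one_mul, abs_of_neg (not_le.1 (mt hside.2 h))]⟩
  rw [slide_of_sign hε hw hσw] at hne heq
  rw [slide_of_sign hε hw' hσw'] at heq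
  have hslope : α * ε - σ * (q - p) ≠ 0 := by
    intro h
    rw [h, zero_mul, zero_div, add_zero] at hne
    exact hne rfl
  field_simp at heq
  exact mul_left_cancel₀ hslope (by linarith)

end Tent

section Snapping

open Filter Topology

lemma intCast_eq_of_abs_sub_lt {u : ℝ} {n m : ℤ} (hn : |u - n| < 1 / 2) (hm : |u - m| < 1 / 2) :
    n = m := by
  have hlt : |(n : ℝ) - m| < 1 := by
    have := abs_sub_le (n : ℝ) u m
    rw [abs_sub_comm (n : ℝ) u] at this
    linarith
  exact sub_eq_zero.1 (Int.abs_lt_one_iff.1 (by exact_mod_cast hlt))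

lemma eventually_mul_lt (c : ℝ) {η : ℝ} (hη : 0 < η) : ∀ᶠ ε in 𝓝[>] (0 : ℝ), c * ε < η :=
  (((continuous_const_mul c).tendsto' 0 0 (mul_zero c)).mono_left
    nhdsWithin_le_nhds).eventually_lt_const hη

lemma eventually_mul_lt_abs_sub_intCast (c v : ℝ) :
    ∀ᶠ ε in 𝓝[>] (0 : ℝ), ∀ z : ℤ, v ≠ z → c * ε < |v - z| := by
  by_cases h : v = round v
  · filter_upwards [eventually_mul_lt c one_pos] with ε hε z hz
    have hne : round v ≠ z := fun h' => hz (h' ▸ h)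
    refine hε.trans_le ?_
    rw [h]
    exact_mod_cast Int.one_le_abs (sub_ne_zero.2 hne)
  · filter_upwards [eventually_mul_lt c (abs_pos.2 (sub_ne_zero.2 h))] with ε hε z _
    exact hε.trans_le (round_le v z)

/-- A family of segments whose endpoints are far from the lines of the integer grid, together with
the maps `snap n` that say where a crossing with a line of index `n` is slid to, and the relation
`owns k n z` that says that, of the two grid lines `z k = n` and `z k.rev = z` through a corner,
it is the former along which segments through this corner are slid. -/
structure SnapData (ι : Type*) where
  start : ι → Fin 2 → ℝ
  finish : ι → Fin 2 → ℝ
  snap : ℤ → ℝ → ℝ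
  owns : Fin 2 → ℤ → ℤ → Prop
  lines : Finset ℤ
  start_far : ∀ i k (n : ℤ), 1 / 4 ≤ |start i k - n|
  finish_far : ∀ i k (n : ℤ), 1 / 4 ≤ |finish i k - n|
  mem_lines : ∀ i k (n : ℤ), (n : ℝ) ∈ uIoo (start i k) (finish i k) → n ∈ lines
  owns_rev : ∀ k n z, owns k.rev z n ↔ ¬ owns k n z
  snap_strictMono : ∀ n, StrictMono (snap n)
  snap_ne : ∀ n v (z : ℤ), snap n v ≠ z
  owns_of_mem : ∀ n k v (z : ℤ), (z : ℝ) ∈ uIcc v (snap n v) → (z : ℝ) ≠ v → owns k n z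

namespace SnapData

variable {ι : Type*}

section Crossing

variable (S : SnapData ι)

/-- The direction vector of the `i`-th segment. -/
def dir (i : ι) (k : Fin 2) : ℝ := S.finish i k - S.start i k

/-- The point with parameter `t` of the `i`-th segment. -/
def pt (i : ι) (t : ℝ) (k : Fin 2) : ℝ := S.start i k + t * S.dir i k

/-- The parameter at which the `i`-th segment crosses the grid line `z k = n`; the junk value is
`0` if the segment is parallel to this line. -/
noncomputable def time (i : ι) (k : Fin 2) (n : ℤ) : ℝ := (n - S.start i k) / S.dir i k

/-- The `i`-th segment crosses the grid line `z k = n`. -/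
def Crosses (i : ι) (k : Fin 2) (n : ℤ) : Prop := (n : ℝ) ∈ uIoo (S.start i k) (S.finish i k)

/-- The position on the grid line `z k = n` at which it is crossed by the `i`-th segment. -/
noncomputable def pos (i : ι) (k : Fin 2) (n : ℤ) : ℝ := S.pt i (S.time i k n) k.rev

/-- The slope of the `i`-th segment over the `k`-th coordinate. -/
noncomputable def slope (i : ι) (k : Fin 2) : ℝ := S.dir i k.rev / S.dir i k

/-- The crossing of the `i`-th segment with the line `z k = n` is slid along this line. -/
def Active (i : ι) (k : Fin 2) (n : ℤ) : Prop :=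
  S.Crosses i k n ∧ ∀ z : ℤ, S.pos i k n = z → S.owns k n z

open Classical in
/-- The distance by which the crossing of the `i`-th segment with `z k = n` is slid. -/
noncomputable def shift (i : ι) (k : Fin 2) (n : ℤ) : ℝ :=
  if S.Active i k n then S.snap n (S.pos i k n) - S.pos i k n else 0

/-- The displacement of the points of the `i`-th segment with `k`-th coordinate `u`. -/
noncomputable def disp (ε : ℝ) (i : ι) (k : Fin 2) (u : ℝ) : ℝ :=
  ∑ n ∈ S.lines, S.shift i k n * tent ε (u - n)

/-- The curve obtained from the `i`-th segment by sliding its crossings with the grid lines. -/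
noncomputable def moved (ε : ℝ) (i : ι) (t : ℝ) (k : Fin 2) : ℝ :=
  S.pt i t k + S.disp ε i k.rev (S.pt i t k.rev)

/-- The point with parameter `t` of the `i`-th segment is within `ε` of the grid line `z k = n`,
along which the segment is slid. -/
structure Near (ε : ℝ) (i : ι) (t : ℝ) (k : Fin 2) (n : ℤ) : Prop where
  active : S.Active i k n
  abs_lt : |S.pt i t k - n| < ε

variable {S} {ε : ℝ} {i : ι} {k : Fin 2} {n z : ℤ} {s t u : ℝ}

lemma Crosses.mem_lines (h : S.Crosses i k n) : n ∈ S.lines := S.mem_lines i k n h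

lemma Crosses.dir_ne_zero (h : S.Crosses i k n) : S.dir i k ≠ 0 := fun h0 => by
  rw [Crosses, sub_eq_zero.1 h0, uIoo_self] at h
  exact h

lemma Crosses.time_mem_Icc (h : S.Crosses i k n) : S.time i k n ∈ Icc (0 : ℝ) 1 := by
  unfold time dir
  rcases lt_or_gt_of_ne (sub_ne_zero.1 h.dir_ne_zero) with hlt | hlt
  · rw [Crosses, uIoo_of_gt hlt] at h
    exact ⟨div_nonneg_of_nonpos (by linarith [h.2]) (by linarith),
      (div_le_one_of_neg (by linarith)).2 (by linarith [h.1])⟩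
  · rw [Crosses, uIoo_of_lt hlt] at h
    exact ⟨div_nonneg (by linarith [h.1]) (by linarith),
      (div_le_one (by linarith)).2 (by linarith [h.2])⟩

lemma Crosses.eq_of_pt_eq (h : S.Crosses i k n) (he : S.pt i s k = S.pt i t k) : s = t :=
  mul_right_cancel₀ h.dir_ne_zero (add_left_cancel he)

lemma Crosses.pt_time (h : S.Crosses i k n) : S.pt i (S.time i k n) k = n := by
  rw [pt, time, div_mul_cancel₀ _ h.dir_ne_zero, add_sub_cancel]

lemma Crosses.pt_rev (h : S.Crosses i k n) (t : ℝ) :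
    S.pt i t k.rev = S.pos i k n + S.slope i k * (S.pt i t k - n) := by
  have := h.dir_ne_zero
  simp only [pos, pt, time, slope]
  field_simp
  ring

lemma crosses_of_abs_lt (ht : t ∈ Icc (0 : ℝ) 1) (h : |S.pt i t k - n| < 1 / 4) :
    S.Crosses i k n := by
  have hstart := le_abs.1 (S.start_far i k n)
  have hfinish := le_abs.1 (S.finish_far i k n)
  obtain ⟨ht0, ht1⟩ := ht
  obtain ⟨hlow, hhigh⟩ := abs_lt.1 h
  unfold pt dir at hlow hhigh
  rcases hstart with hstart | hstart <;> rcases hfinish with hfinish | hfinish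
  · nlinarith
  · exact mem_uIoo_of_gt (by linarith) (by linarith)
  · exact mem_uIoo_of_lt (by linarith) (by linarith)
  · nlinarith

lemma Crosses.rev_of_pos_eq (h : S.Crosses i k n) (hz : S.pos i k n = z) :
    S.Crosses i k.rev z ∧ S.pos i k.rev z = n := by
  have hpt : S.pt i (S.time i k n) k.rev = z := hz
  have hcross : S.Crosses i k.rev z := by
    refine crosses_of_abs_lt h.time_mem_Icc ?_
    rw [hpt, sub_self, abs_zero]
    norm_num
  refine ⟨hcross, ?_⟩
  have := hcross.pt_rev (S.time i k n)
  rw [Fin.rev_rev, h.pt_time, hpt, sub_self, mul_zero, add_zero] at this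
  exact this.symm

lemma Active.shift_eq (h : S.Active i k n) :
    S.shift i k n = S.snap n (S.pos i k n) - S.pos i k n := if_pos h

lemma shift_of_not_active (h : ¬ S.Active i k n) : S.shift i k n = 0 := if_neg h

lemma Active.owns_of_mem (h : S.Active i k n)
    (hz : (z : ℝ) ∈ uIcc (S.pos i k n) (S.snap n (S.pos i k n))) : S.owns k n z := by
  by_cases heq : (z : ℝ) = S.pos i k n
  · exact h.2 z heq.symm
  · exact S.owns_of_mem n k _ z hz heq

lemma exists_active_of_crosses (h : S.Crosses i k n) :
    S.Active i k n ∨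
      ∃ z : ℤ, S.pos i k n = z ∧ S.owns k.rev z n ∧ S.Active i k.rev z := by
  by_cases ha : S.Active i k n
  · exact Or.inl ha
  simp only [Active, h, true_and, not_forall, ← S.owns_rev] at ha
  obtain ⟨z, hz, howns⟩ := ha
  obtain ⟨hcross, hpos⟩ := h.rev_of_pos_eq hz
  refine Or.inr ⟨z, hz, howns, hcross, fun y hy => ?_⟩
  rwa [← Int.cast_injective (hpos.symm.trans hy)]

lemma disp_of_abs_lt (hε0 : 0 < ε) (hε : ε < 1 / 4) (hu : |u - n| < ε) :
    S.disp ε i k u = S.shift i k n * tent ε (u - n) := by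
  refine Finset.sum_eq_single n (fun m _ hm => ?_) fun hn => ?_
  · rw [tent_of_le_abs hε0, mul_zero]
    by_contra! hlt
    exact hm (intCast_eq_of_abs_sub_lt (u := u) (by linarith) (by linarith))
  · rw [shift_of_not_active fun h => hn h.1.mem_lines, zero_mul]

lemma disp_eq_zero (hε : 0 < ε) (hu : ∀ n : ℤ, |u - n| < ε → ¬ S.Active i k n) :
    S.disp ε i k u = 0 := by
  refine Finset.sum_eq_zero fun n _ => ?_
  by_cases h : |u - n| < ε
  · rw [shift_of_not_active (hu n h), zero_mul]
  · rw [tent_of_le_abs hε (not_lt.1 h), mul_zero]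

lemma moved_eq_pt_of_not_near (hε : 0 < ε) (h : ∀ k n, ¬ S.Near ε i t k n) :
    S.moved ε i t = S.pt i t := by
  ext k
  rw [moved, disp_eq_zero hε fun n hn ha => h _ n ⟨ha, hn⟩, add_zero]

lemma continuous_moved (ε : ℝ) (i : ι) : Continuous (S.moved ε i) := by
  have hpt : ∀ k, Continuous fun t => S.pt i t k := fun k => by unfold pt; fun_prop
  refine continuous_pi fun k => (hpt k).add (continuous_finsetSum _ fun n _ => ?_)
  exact ((continuous_tent ε).comp ((hpt _).sub continuous_const)).const_mul _

end Crossing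

section Fine

variable [Fintype ι] (S : SnapData ι)

/-- A bound for the slopes of all segments. -/
noncomputable def slopeBound : ℝ := ∑ i, ∑ k, |S.slope i k|

/-- The width `ε` is small compared to all distances between crossings and corners, before and
after snapping. -/
structure IsFine (ε : ℝ) : Prop where
  pos : 0 < ε
  lt : ε < 1 / 4
  pos_sep : ∀ i j k, ∀ n ∈ S.lines, S.pos i k n < S.pos j k n →
    2 * S.slopeBound * ε < S.pos j k n - S.pos i k n
  snap_sep : ∀ i j k, ∀ n ∈ S.lines, S.pos i k n < S.pos j k n →
    2 * S.slopeBound * ε < S.snap n (S.pos j k n) - S.snap n (S.pos i k n)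
  pos_far : ∀ i k, ∀ n ∈ S.lines, ∀ z : ℤ, S.pos i k n ≠ z →
    (2 * S.slopeBound + 1) * ε < |S.pos i k n - z|
  snap_far : ∀ i k, ∀ n ∈ S.lines, ∀ z : ℤ,
    (2 * S.slopeBound + 1) * ε < |S.snap n (S.pos i k n) - z|

lemma eventually_isFine : ∀ᶠ ε in 𝓝[>] (0 : ℝ), S.IsFine ε := by
  have hlt : ∀ᶠ ε in 𝓝[>] (0 : ℝ), ε < 1 / 4 := by
    simpa only [one_mul] using eventually_mul_lt 1 (η := 1 / 4) (by norm_num)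
  have hpos_sep : ∀ᶠ ε in 𝓝[>] (0 : ℝ), ∀ i j k, ∀ n ∈ S.lines, S.pos i k n < S.pos j k n →
      2 * S.slopeBound * ε < S.pos j k n - S.pos i k n := by
    simp only [eventually_all, eventually_all_finset]
    exact fun i j k n _ h => eventually_mul_lt _ (sub_pos.2 h)
  have hsnap_sep : ∀ᶠ ε in 𝓝[>] (0 : ℝ), ∀ i j k, ∀ n ∈ S.lines, S.pos i k n < S.pos j k n →
      2 * S.slopeBound * ε < S.snap n (S.pos j k n) - S.snap n (S.pos i k n) := by
    simp only [eventually_all, eventually_all_finset]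
    exact fun i j k n _ h => eventually_mul_lt _ (sub_pos.2 (S.snap_strictMono n h))
  have hpos_far : ∀ᶠ ε in 𝓝[>] (0 : ℝ), ∀ i k, ∀ n ∈ S.lines, ∀ z : ℤ, S.pos i k n ≠ z →
      (2 * S.slopeBound + 1) * ε < |S.pos i k n - z| := by
    simp only [eventually_all, eventually_all_finset]
    exact fun i k n _ => eventually_mul_lt_abs_sub_intCast _ _
  have hsnap_far : ∀ᶠ ε in 𝓝[>] (0 : ℝ), ∀ i k, ∀ n ∈ S.lines, ∀ z : ℤ,
      (2 * S.slopeBound + 1) * ε < |S.snap n (S.pos i k n) - z| := by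
    simp only [eventually_all, eventually_all_finset]
    exact fun i k n _ => (eventually_mul_lt_abs_sub_intCast _ _).mono
      fun ε h z => h z (S.snap_ne n _ z)
  filter_upwards [self_mem_nhdsWithin, hlt, hpos_sep, hsnap_sep, hpos_far, hsnap_far]
    with ε h₁ h₂ h₃ h₄ h₅ h₆ using ⟨h₁, h₂, h₃, h₄, h₅, h₆⟩

variable {S} {ε : ℝ} {i j : ι} {k : Fin 2} {n z : ℤ} {s t : ℝ}

lemma slopeBound_nonneg : 0 ≤ S.slopeBound :=
  Finset.sum_nonneg fun _ _ => Finset.sum_nonneg fun _ _ => abs_nonneg _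

lemma abs_slope_le (i : ι) (k : Fin 2) : |S.slope i k| ≤ S.slopeBound :=
  calc |S.slope i k| ≤ ∑ k, |S.slope i k| :=
        Finset.single_le_sum (fun l _ => abs_nonneg (S.slope i l)) (Finset.mem_univ k)
    _ ≤ S.slopeBound :=
        Finset.single_le_sum (f := fun i => ∑ k, |S.slope i k|)
          (fun _ _ => Finset.sum_nonneg fun _ _ => abs_nonneg _) (Finset.mem_univ i)

lemma abs_slope_mul_le (hw : |S.pt i t k - n| < ε) :
    |S.slope i k * (S.pt i t k - n)| ≤ S.slopeBound * ε := by
  rw [abs_mul]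
  exact mul_le_mul (abs_slope_le i k) hw.le (abs_nonneg _) slopeBound_nonneg

namespace IsFine

variable (hε : S.IsFine ε)

include hε

lemma slopeBound_mul_nonneg : 0 ≤ S.slopeBound * ε := mul_nonneg slopeBound_nonneg hε.pos.le

lemma pos_eq (h : S.Crosses i k n) (hw : |S.pt i t k - n| < ε) (hw' : |S.pt i t k.rev - z| < ε) :
    S.pos i k n = z := by
  by_contra hz
  have hfar := hε.pos_far i k n h.mem_lines z hz
  have htri := abs_sub_le (S.pos i k n) (S.pt i t k.rev) z
  have hrev : |S.pos i k n - S.pt i t k.rev| ≤ S.slopeBound * ε := by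
    rw [h.pt_rev t, sub_add_cancel_left, abs_neg]
    exact abs_slope_mul_le hw
  linarith [hε.slopeBound_mul_nonneg]

lemma not_active_rev (h : S.Near ε i t k n) (hw : |S.pt i t k.rev - z| < ε) :
    ¬ S.Active i k.rev z := by
  intro h'
  have howns := h.active.2 z (hε.pos_eq h.active.1 h.abs_lt hw)
  have howns' := h'.2 n (hε.pos_eq h'.1 hw (by rw [Fin.rev_rev]; exact h.abs_lt))
  exact (S.owns_rev k n z).1 howns' howns

end IsFine

namespace Near

variable (hε : S.IsFine ε)

include hε

lemma moved_eq (h : S.Near ε i t k n) : S.moved ε i t k = S.pt i t k := by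
  rw [moved, disp_eq_zero hε.pos fun z hz => hε.not_active_rev h hz, add_zero]

lemma moved_rev (h : S.Near ε i t k n) : S.moved ε i t k.rev =
    slide ε (S.pos i k n) (S.snap n (S.pos i k n)) (S.slope i k) (S.pt i t k - n) := by
  rw [moved, Fin.rev_rev, disp_of_abs_lt hε.pos hε.lt h.abs_lt, h.active.shift_eq,
    h.active.1.pt_rev, slide]
  ring

lemma abs_moved_sub_lt (h : S.Near ε i t k n) : |S.moved ε i t k - n| < ε := by
  rw [h.moved_eq hε]
  exact h.abs_lt

lemma moved_rev_of_moved_eq (h : S.Near ε i t k n) (hn : S.moved ε i t k = n) :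
    S.moved ε i t k.rev = S.snap n (S.pos i k n) := by
  rw [h.moved_rev hε, ← h.moved_eq hε, hn, sub_self, slide_zero]

lemma lt_abs_moved_rev_sub (h : S.Near ε i t k n) (hz : S.owns k.rev z n) :
    S.slopeBound * ε + ε < |S.moved ε i t k.rev - z| := by
  have hn := h.active.1.mem_lines
  have hnot : (z : ℝ) ∉ uIcc (S.pos i k n) (S.snap n (S.pos i k n)) := fun hmem =>
    (S.owns_rev k n z).1 hz (h.active.owns_of_mem hmem)
  have hpos := hε.pos_far i k n hn z fun heq => hnot (heq ▸ left_mem_uIcc)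
  have hsnap := hε.snap_far i k n hn z
  rw [h.moved_rev hε]
  exact lt_abs_slide_sub hnot (by linarith) (by linarith) (abs_slope_mul_le h.abs_lt)

lemma owns_of_moved_rev_eq (h : S.Near ε i t k n) (hz : S.moved ε i t k.rev = z) :
    S.owns k n z := by
  by_contra hnot
  have hfar := h.lt_abs_moved_rev_sub hε ((S.owns_rev k n z).2 hnot)
  rw [hz, sub_self, abs_zero] at hfar
  linarith [hε.slopeBound_mul_nonneg, hε.pos]

lemma not_near_rev (h : S.Near ε i t k n) (he : S.moved ε i t = S.moved ε j s) :
    ¬ S.Near ε j s k.rev z := by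
  intro h'
  by_cases howns : S.owns k n z
  · have hfar := h'.lt_abs_moved_rev_sub hε (z := n) (by rwa [Fin.rev_rev])
    rw [Fin.rev_rev, ← he] at hfar
    linarith [h.abs_moved_sub_lt hε, hε.slopeBound_mul_nonneg]
  · have hfar := h.lt_abs_moved_rev_sub hε ((S.owns_rev k n z).2 howns)
    rw [he] at hfar
    linarith [h'.abs_moved_sub_lt hε, hε.slopeBound_mul_nonneg]

lemma pt_eq_of_moved_eq (h : S.Near ε i t k n) (h' : S.Near ε j s k n)
    (he : S.moved ε i t = S.moved ε j s) : S.pt i t k = S.pt j s k := by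
  rw [← h.moved_eq hε, ← h'.moved_eq hε, he]

lemma pos_le (h : S.Near ε i t k n) (h' : S.Near ε j s k n)
    (he : S.moved ε i t = S.moved ε j s) : S.pos j k n ≤ S.pos i k n := by
  by_contra! hlt
  have hn := h.active.1.mem_lines
  have hcoord := h.pt_eq_of_moved_eq hε h' he
  have hpos := hε.pos_sep i j k n hn hlt
  have hsnap := hε.snap_sep i j k n hn hlt
  rw [mul_assoc] at hpos hsnap
  have hslide := slide_lt_slide (ε := ε) hpos hsnap (abs_slope_mul_le h.abs_lt)
    (by rw [hcoord]; exact abs_slope_mul_le h'.abs_lt)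
  rw [← h.moved_rev hε, hcoord, ← h'.moved_rev hε, he] at hslide
  exact hslide.false

lemma pt_eq (h : S.Near ε i t k n) (h' : S.Near ε j s k n)
    (he : S.moved ε i t = S.moved ε j s) : S.pt i t = S.pt j s := by
  have hpos : S.pos i k n = S.pos j k n :=
    le_antisymm (h'.pos_le hε h he.symm) (h.pos_le hε h' he)
  have hcoord := h.pt_eq_of_moved_eq hε h' he
  have hrev : S.pt i t k.rev = S.pt j s k.rev := by
    have hmoved := congrFun he k.rev
    rw [h.moved_rev hε, h'.moved_rev hε, hpos, hcoord, slide, slide] at hmoved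
    rw [h.active.1.pt_rev, h'.active.1.pt_rev, hpos, hcoord, add_left_cancel hmoved]
  ext l
  rcases eq_or_eq_rev k l with rfl | rfl <;> assumption

lemma moved_ne_pt (hs : s ∈ Icc (0 : ℝ) 1) (h : S.Near ε i t k n)
    (h' : ∀ k n, ¬ S.Near ε j s k n) : S.moved ε i t ≠ S.pt j s := by
  intro he
  have hw : |S.pt j s k - n| < ε := by
    rw [← he]
    exact h.abs_moved_sub_lt hε
  have hcross : S.Crosses j k n := crosses_of_abs_lt hs (hw.trans hε.lt)
  rcases exists_active_of_crosses hcross with ha | ⟨z, hz, howns, -⟩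
  · exact h' k n ⟨ha, hw⟩
  · have hfar := h.lt_abs_moved_rev_sub hε howns
    rw [he, hcross.pt_rev s, hz, add_sub_cancel_left] at hfar
    linarith [abs_slope_mul_le hw, hε.pos]

lemma eq_of_moved_rev_eq (hs : S.Near ε i s k n) (ht : S.Near ε i t k n)
    (hs' : S.moved ε i s k.rev = z) (ht' : S.moved ε i t k.rev = z)
    (hside : n ≤ S.pt i s k ↔ n ≤ S.pt i t k) : s = t := by
  rw [hs.moved_rev hε] at hs'
  rw [ht.moved_rev hε] at ht'
  have hw := eq_of_slide_eq_slide hε.pos hs.abs_lt.le ht.abs_lt.le (by simpa only [sub_nonneg])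
    (by rw [hs']; exact (S.snap_ne n _ z).symm) (hs'.trans ht'.symm)
  exact hs.active.1.eq_of_pt_eq (sub_left_injective hw)

lemma finite_setOf_moved_eq (i : ι) (k : Fin 2) (n : ℤ) :
    {t | S.Near ε i t k n ∧ S.moved ε i t k = n}.Finite := by
  refine Subsingleton.finite fun s hs t ht => hs.1.active.1.eq_of_pt_eq ?_
  rw [← hs.1.moved_eq hε, ← ht.1.moved_eq hε, hs.2, ht.2]

lemma finite_setOf_moved_rev_eq (i : ι) (k : Fin 2) (n z : ℤ) :
    {t | S.Near ε i t k n ∧ S.moved ε i t k.rev = z}.Finite :=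
  Finite.of_injOn (f := fun t => n ≤ S.pt i t k) (mapsTo_univ _ _)
    (fun _ hs _ ht hside => hs.1.eq_of_moved_rev_eq hε ht.1 hs.2 ht.2 hside.to_iff) finite_univ

end Near

namespace IsFine

variable (hε : S.IsFine ε)

include hε

lemma pt_eq_of_moved_eq (ht : t ∈ Icc (0 : ℝ) 1) (hs : s ∈ Icc (0 : ℝ) 1)
    (he : S.moved ε i t = S.moved ε j s) : S.pt i t = S.pt j s := by
  by_cases hi : ∃ k n, S.Near ε i t k n <;> by_cases hj : ∃ k n, S.Near ε j s k n
  · obtain ⟨k, n, h⟩ := hi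
    obtain ⟨l, m, h'⟩ := hj
    rcases eq_or_eq_rev k l with rfl | rfl
    · have hm := h'.abs_moved_sub_lt hε
      rw [← he] at hm
      obtain rfl : n = m := intCast_eq_of_abs_sub_lt
        ((h.abs_moved_sub_lt hε).trans (by linarith [hε.lt])) (hm.trans (by linarith [hε.lt]))
      exact h.pt_eq hε h' he
    · exact absurd h' (h.not_near_rev hε he)
  · obtain ⟨k, n, h⟩ := hi
    push Not at hj
    exact absurd (he.trans (moved_eq_pt_of_not_near hε.pos hj)) (h.moved_ne_pt hε hs hj)
  · obtain ⟨k, n, h⟩ := hj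
    push Not at hi
    exact absurd (he.symm.trans (moved_eq_pt_of_not_near hε.pos hi)) (h.moved_ne_pt hε ht hi)
  · push Not at hi hj
    rw [← moved_eq_pt_of_not_near hε.pos hi, he, moved_eq_pt_of_not_near hε.pos hj]

lemma moved_eq_pt_of_far (h : ∀ k (n : ℤ), 1 / 4 ≤ |S.pt i t k - n|) :
    S.moved ε i t = S.pt i t :=
  moved_eq_pt_of_not_near hε.pos fun k n hnear =>
    (h k n).not_gt (hnear.abs_lt.trans hε.lt)

lemma moved_zero (i : ι) : S.moved ε i 0 = S.start i := by
  have hpt : S.pt i 0 = S.start i := by ext k; rw [pt, zero_mul, add_zero]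
  rw [hε.moved_eq_pt_of_far (by rw [hpt]; exact S.start_far i), hpt]

lemma moved_one (i : ι) : S.moved ε i 1 = S.finish i := by
  have hpt : S.pt i 1 = S.finish i := by ext k; rw [pt, one_mul, dir, add_sub_cancel]
  rw [hε.moved_eq_pt_of_far (by rw [hpt]; exact S.finish_far i), hpt]

lemma near_of_moved_eq_intCast (ht : t ∈ Icc (0 : ℝ) 1) (h : S.moved ε i t k = n) :
    S.Near ε i t k n ∨ ∃ z, S.Near ε i t k.rev z := by
  by_cases hnear : ∃ l m, S.Near ε i t l m
  · obtain ⟨l, m, hlm⟩ := hnear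
    rcases eq_or_eq_rev k l with rfl | rfl
    · have hm := hlm.abs_moved_sub_lt hε
      obtain rfl : m = n := intCast_eq_of_abs_sub_lt (hm.trans (by linarith [hε.lt]))
        (by rw [h, sub_self, abs_zero]; norm_num)
      exact Or.inl hlm
    · exact Or.inr ⟨m, hlm⟩
  · push Not at hnear
    have hpt : S.pt i t k = n := by rw [← moved_eq_pt_of_not_near hε.pos hnear, h]
    have hw : |S.pt i t k - n| < ε := by rw [hpt, sub_self, abs_zero]; exact hε.pos
    have hcross : S.Crosses i k n := crosses_of_abs_lt ht (hw.trans hε.lt)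
    rcases exists_active_of_crosses hcross with ha | ⟨z, hz, -, ha⟩
    · exact Or.inl ⟨ha, hw⟩
    · refine Or.inr ⟨z, ha, ?_⟩
      rw [hcross.pt_rev t, hz, hpt, sub_self, mul_zero, add_zero, sub_self, abs_zero]
      exact hε.pos

lemma moved_rev_ne_intCast (ht : t ∈ Icc (0 : ℝ) 1) (h : S.moved ε i t k = n) (z : ℤ) :
    S.moved ε i t k.rev ≠ z := by
  intro hz
  rcases hε.near_of_moved_eq_intCast ht h with hnear | ⟨m, hnear⟩
  · exact S.snap_ne n _ z ((hnear.moved_rev_of_moved_eq hε h).symm.trans hz)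
  · obtain rfl : m = z := intCast_eq_of_abs_sub_lt
      ((hnear.abs_moved_sub_lt hε).trans (by linarith [hε.lt]))
      (by rw [hz, sub_self, abs_zero]; norm_num)
    have hsnap := hnear.moved_rev_of_moved_eq hε hz
    rw [Fin.rev_rev, h] at hsnap
    exact S.snap_ne m _ n hsnap.symm

lemma finite_setOf_moved_eq_intCast (i : ι) (T : Finset ℤ) :
    {t ∈ Icc (0 : ℝ) 1 | ∃ k, ∃ n ∈ T, S.moved ε i t k = n}.Finite := by
  have hfin : (⋃ k, ⋃ n ∈ S.lines, ({t | S.Near ε i t k n ∧ S.moved ε i t k = n} ∪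
      ⋃ z ∈ T, {t | S.Near ε i t k n ∧ S.moved ε i t k.rev = z})).Finite :=
    finite_iUnion fun k => S.lines.finite_toSet.biUnion fun n _ =>
      (Near.finite_setOf_moved_eq hε i k n).union
        (T.finite_toSet.biUnion fun z _ => Near.finite_setOf_moved_rev_eq hε i k n z)
  refine hfin.subset ?_
  rintro t ⟨ht, k, n, hn, h⟩
  simp only [mem_iUnion, mem_union, exists_prop]
  rcases hε.near_of_moved_eq_intCast ht h with hnear | ⟨z, hnear⟩
  · exact ⟨k, n, hnear.active.1.mem_lines, Or.inl ⟨hnear, h⟩⟩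
  · exact ⟨k.rev, z, hnear.active.1.mem_lines, Or.inr ⟨n, hn, hnear, by rwa [Fin.rev_rev]⟩⟩

end IsFine

end Fine

end SnapData

end Snapping

section Length

lemma eVariationOn_le_of_dist_le {E : Type*} [PseudoMetricSpace E] {f : unitInterval → E}
    {V : ℝ → ℝ} (h : ∀ s t : unitInterval, s ≤ t → dist (f s) (f t) ≤ V t - V s) :
    eVariationOn f univ ≤ ENNReal.ofReal (V 1 - V 0) := by
  have hmono : Monotone fun t : unitInterval => V t := fun s t hst =>
    sub_nonneg.1 (dist_nonneg.trans (h s t hst))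
  have hle : eVariationOn f univ ≤ eVariationOn (fun t : unitInterval => V t) univ := by
    refine iSup_mono fun p => Finset.sum_le_sum fun i _ => ?_
    rw [edist_dist, edist_dist, dist_comm, Real.dist_eq]
    exact ENNReal.ofReal_le_ofReal ((h _ _ (p.2.2.1 i.le_succ)).trans (le_abs_self _))
  have hV := (hmono.monotoneOn univ).eVariationOn_eq (mem_univ 0) (mem_univ 1)
  have huniv : univ ∩ Icc (0 : unitInterval) 1 = univ := by
    rw [univ_inter, eq_univ_iff_forall]
    exact fun t => ⟨t.2.1, t.2.2⟩
  rw [huniv] at hV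
  exact hle.trans hV.le

section Norm

variable {ι : Type*} [Fintype ι] (v : EuclideanSpace ℝ ι)

lemma norm_le_sum_abs : ‖v‖ ≤ ∑ k, |v k| := by
  rw [EuclideanSpace.norm_eq]
  exact Real.sqrt_le_iff.2 ⟨Finset.sum_nonneg fun _ _ => abs_nonneg _,
    Finset.sum_sq_le_sq_sum_of_nonneg fun _ _ => abs_nonneg _⟩

lemma sum_abs_le_sqrt_card_mul_norm : ∑ k, |v k| ≤ √(Fintype.card ι) * ‖v‖ := by
  rw [EuclideanSpace.norm_eq, ← Real.sqrt_mul (Nat.cast_nonneg _)]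
  exact Real.le_sqrt_of_sq_le sq_sum_le_card_mul_sum_sq

end Norm

namespace SnapData

variable {ι : Type*} (S : SnapData ι)

/-- A function of the parameter `t` of the `i`-th segment whose increments are the variations of
the tent around the grid line `z k = n` along this segment. -/
noncomputable def tentVariation (ε : ℝ) (i : ι) (k : Fin 2) (n : ℤ) (t : ℝ) : ℝ :=
  if 0 ≤ S.dir i k then clamp ε (S.pt i t k - n) else -clamp ε (S.pt i t k - n)

variable {S} {ε : ℝ} {i : ι} {k : Fin 2} {n : ℤ} {s t : ℝ}

lemma abs_tent_sub_le_tentVariation (hε : 0 ≤ ε) (hst : s ≤ t) :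
    |tent ε (S.pt i s k - n) - tent ε (S.pt i t k - n)| ≤
      S.tentVariation ε i k n t - S.tentVariation ε i k n s := by
  refine (abs_tent_sub_le _ _ _).trans (le_of_eq ?_)
  unfold tentVariation
  split_ifs with h
  · have hpt : S.pt i s k - n ≤ S.pt i t k - n := by unfold pt; gcongr
    rw [abs_of_nonpos (sub_nonpos.2 (clamp_mono hε hpt)), neg_sub]
  · have hpt : S.pt i t k - n ≤ S.pt i s k - n := by
      unfold pt
      linarith [mul_le_mul_of_nonpos_right hst (not_le.1 h).le]
    rw [abs_of_nonneg (sub_nonneg.2 (clamp_mono hε hpt)), neg_sub_neg]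

lemma tentVariation_sub_le (ε : ℝ) (i : ι) (k : Fin 2) (n : ℤ) (s t : ℝ) :
    S.tentVariation ε i k n t - S.tentVariation ε i k n s ≤ 2 := by
  have hs := abs_le.1 (abs_clamp_le_one ε (S.pt i s k - n))
  have ht := abs_le.1 (abs_clamp_le_one ε (S.pt i t k - n))
  unfold tentVariation
  split_ifs <;> linarith

lemma abs_disp_sub_le (hε : 0 ≤ ε) (hst : s ≤ t) (i : ι) (k : Fin 2) :
    |S.disp ε i k (S.pt i s k) - S.disp ε i k (S.pt i t k)| ≤
      ∑ n ∈ S.lines, |S.shift i k n| * (S.tentVariation ε i k n t - S.tentVariation ε i k n s) := by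
  unfold disp
  rw [← Finset.sum_sub_distrib]
  refine (Finset.abs_sum_le_sum_abs _ _).trans (Finset.sum_le_sum fun n _ => ?_)
  rw [← mul_sub, abs_mul]
  gcongr
  exact abs_tent_sub_le_tentVariation hε hst

lemma norm_toLp_moved_sub_le (hε : 0 ≤ ε) (hst : s ≤ t) (i : ι) :
    ‖WithLp.toLp 2 (S.moved ε i s - S.moved ε i t)‖ ≤ (t - s) * ‖WithLp.toLp 2 (S.dir i)‖ +
      ∑ k, ∑ n ∈ S.lines,
        |S.shift i k n| * (S.tentVariation ε i k n t - S.tentVariation ε i k n s) := by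
  let displacement : Fin 2 → ℝ := fun k =>
    S.disp ε i k.rev (S.pt i s k.rev) - S.disp ε i k.rev (S.pt i t k.rev)
  have hsplit : S.moved ε i s - S.moved ε i t = (s - t) • S.dir i + displacement := by
    ext k
    simp only [moved, pt, displacement, Pi.add_apply, Pi.sub_apply, Pi.smul_apply, smul_eq_mul]
    ring
  rw [hsplit, WithLp.toLp_add, WithLp.toLp_smul]
  refine (norm_add_le _ _).trans (add_le_add ?_ ?_)
  · rw [norm_smul, Real.norm_of_nonpos (sub_nonpos.2 hst), neg_sub]
  · refine (norm_le_sum_abs _).trans ?_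
    rw [← Equiv.sum_comp Fin.revPerm]
    refine Finset.sum_le_sum fun k _ => ?_
    simp only [displacement, Fin.revPerm_apply, Fin.rev_rev]
    exact abs_disp_sub_le hε hst i k

lemma eVariationOn_moved_le (hε : 0 ≤ ε) (i : ι) (o : Fin 2 → ℝ) :
    eVariationOn (fun t : unitInterval => (WithLp.toLp 2 (o + S.moved ε i t) : Plane)) univ ≤
      ENNReal.ofReal (‖WithLp.toLp 2 (S.dir i)‖ + ∑ k, ∑ n ∈ S.lines, 2 * |S.shift i k n|) := by
  let V (t : ℝ) : ℝ := t * ‖WithLp.toLp 2 (S.dir i)‖ +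
    ∑ k, ∑ n ∈ S.lines, |S.shift i k n| * S.tentVariation ε i k n t
  have hV : ∀ s t, V t - V s = (t - s) * ‖WithLp.toLp 2 (S.dir i)‖ + ∑ k, ∑ n ∈ S.lines,
      |S.shift i k n| * (S.tentVariation ε i k n t - S.tentVariation ε i k n s) := fun s t => by
    simp only [V, mul_sub, Finset.sum_sub_distrib]
    ring
  refine (eVariationOn_le_of_dist_le (V := V) fun s t hst => ?_).trans
    (ENNReal.ofReal_le_ofReal ?_)
  · rw [hV, dist_eq_norm, ← WithLp.toLp_sub, add_sub_add_left_eq_sub]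
    exact norm_toLp_moved_sub_le hε hst i
  · rw [hV, sub_zero, one_mul]
    refine add_le_add le_rfl (Finset.sum_le_sum fun k _ => Finset.sum_le_sum fun n _ => ?_)
    rw [mul_comm]
    exact mul_le_mul_of_nonneg_right (tentVariation_sub_le ε i k n 0 1) (abs_nonneg _)

end SnapData

end Length

section Grid

variable {L : ℕ} {a : Fin L × Fin L} {x y : Plane} {k : Fin 2} {n P : ℤ} {u v : ℝ}

/-- The two components of the shift of the dissection `D(a)`. -/
def offset (a : Fin L × Fin L) : Fin 2 → Fin L := ![a.1, a.2]

lemma corner_eq (a : Fin L × Fin L) (k : Fin 2) : corner a k = -(offset a k : ℝ) - 1 / 2 := by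
  fin_cases k <;> rfl

lemma sum_offset (k : Fin 2) (f : Fin L → ℝ) :
    ∑ a : Fin L × Fin L, f (offset a k) = L * ∑ b, f b := by
  rw [Fintype.sum_prod_type]
  match k with
  | 0 => simp [offset, Finset.mul_sum]
  | 1 => simp [offset]

lemma exists_natCast_abs_sub_lt (hx : x ∈ Metric.thickening (1 / 4) (lattice L)) (k : Fin 2) :
    ∃ j : ℕ, j ≤ L ∧ |x k - j| < 1 / 4 := by
  obtain ⟨z, ⟨i, j, hi, hj, rfl⟩, hd⟩ := Metric.mem_thickening_iff.1 hx
  have h : ∀ k, |x k - !₂[(i : ℝ), (j : ℝ)] k| < 1 / 4 := fun k =>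
    (PiLp.norm_apply_le (x - !₂[(i : ℝ), (j : ℝ)]) k).trans_lt (by rwa [← dist_eq_norm])
  match k with
  | 0 => exact ⟨i, hi, h 0⟩
  | 1 => exact ⟨j, hj, h 1⟩

lemma quarter_le_abs_sub_corner_sub (hx : x ∈ Metric.thickening (1 / 4) (lattice L))
    (a : Fin L × Fin L) (k : Fin 2) (n : ℤ) : 1 / 4 ≤ |x k - corner a k - n| := by
  obtain ⟨j, -, hj⟩ := exists_natCast_abs_sub_lt hx k
  obtain ⟨hlow, hhigh⟩ := abs_lt.1 hj
  rw [corner_eq]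
  rcases le_or_gt (j + offset a k + 1 : ℤ) n with h | h
  · have h' : (j : ℝ) + offset a k + 1 ≤ n := mod_cast h
    exact le_trans (by linarith) (neg_le_abs _)
  · have h' : (n : ℝ) ≤ j + offset a k := mod_cast Int.lt_add_one_iff.1 h
    exact le_trans (by linarith) (le_abs_self _)

lemma sub_corner_mem_Ioo (hx : x ∈ Metric.thickening (1 / 4) (lattice L)) (a : Fin L × Fin L)
    (k : Fin 2) : x k - corner a k ∈ Ioo (0 : ℝ) (2 * L) := by
  obtain ⟨j, hj, hxj⟩ := exists_natCast_abs_sub_lt hx k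
  obtain ⟨hlow, hhigh⟩ := abs_lt.1 hxj
  have hjL : (j : ℝ) ≤ L := mod_cast hj
  have haL : ((offset a k : ℕ) : ℝ) + 1 ≤ L := mod_cast (offset a k).2
  rw [corner_eq]
  constructor <;> linarith [j.cast_nonneg (α := ℝ), (offset a k : ℕ).cast_nonneg (α := ℝ)]

/-- The indices `P` of the half-integers `P - 1 / 2` strictly between `u` and `v`. For every shift
`a`, the grid lines of `D(a)` meet the coordinate axes in half-integers only. -/
noncomputable def crossings (u v : ℝ) : Finset ℤ :=
  Finset.Ioo ⌊min u v + 1 / 2⌋ ⌈max u v + 1 / 2⌉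

lemma mem_crossings : P ∈ crossings u v ↔ (P : ℝ) - 1 / 2 ∈ uIoo u v := by
  rw [crossings, Finset.mem_Ioo, Int.floor_lt, Int.lt_ceil, uIoo, mem_Ioo, lt_sub_iff_add_lt,
    sub_lt_iff_lt_add]

lemma card_crossings_le {i j : ℤ} (hu : |u - i| < 1 / 4) (hv : |v - j| < 1 / 4) :
    ((crossings u v).card : ℝ) ≤ 2 * |v - u| := by
  wlog huv : u ≤ v generalizing u v i j
  · rw [abs_sub_comm, crossings, min_comm, max_comm]
    exact this hv hu (not_le.1 huv).le
  obtain ⟨hu₀, hu₁⟩ := abs_lt.1 hu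
  obtain ⟨hv₀, hv₁⟩ := abs_lt.1 hv
  have hfloor : ⌊u + 1 / 2⌋ = i := Int.floor_eq_iff.2 ⟨by linarith, by linarith⟩
  have hceil : ⌈v + 1 / 2⌉ = j + 1 :=
    Int.ceil_eq_iff.2 ⟨by push_cast; linarith, by push_cast; linarith⟩
  have hij : i ≤ j := Int.lt_add_one_iff.1 (mod_cast (by linarith : (i : ℝ) < j + 1))
  have hcard : ((crossings u v).card : ℝ) = j - i := by
    rw [crossings, min_eq_left huv, max_eq_right huv, hfloor, hceil, Int.card_Ioo,
      add_sub_right_comm, add_sub_cancel_right]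
    exact_mod_cast Int.toNat_of_nonneg (sub_nonneg.2 hij)
  rw [hcard, abs_of_nonneg (sub_nonneg.2 huv)]
  rcases hij.eq_or_lt with rfl | hlt
  · linarith
  · have : (i : ℝ) + 1 ≤ j := mod_cast hlt
    linarith

lemma mem_gridLines {g : Set Plane} (hg : g ∈ gridLines a) :
    ∃ k, ∃ n ∈ Finset.Ioo (0 : ℤ) (2 * L), g = {z : Plane | z k = corner a k + n} := by
  obtain ⟨n, hn, hnL, rfl | rfl⟩ := hg
  · exact ⟨0, n, Finset.mem_Ioo.2 ⟨by omega, by omega⟩, rfl⟩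
  · exact ⟨1, n, Finset.mem_Ioo.2 ⟨by omega, by omega⟩, rfl⟩

lemma setOf_apply_eq_mem_gridLines (hn : n ∈ Finset.Ioo (0 : ℤ) (2 * L)) (k : Fin 2) :
    {z : Plane | z k = corner a k + n} ∈ gridLines a := by
  rw [Finset.mem_Ioo] at hn
  lift n to ℕ using hn.1.le
  refine ⟨n, by omega, by omega, ?_⟩
  match k with
  | 0 => exact Or.inl rfl
  | 1 => exact Or.inr rfl

lemma mem_thickening_gridUnion (hn : n ∈ Finset.Ioo (0 : ℤ) (2 * L)) {z : Plane} {δ : ℝ}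
    (h : |z k - corner a k - n| < δ) : z ∈ Metric.thickening δ (gridUnion a) := by
  refine Metric.mem_thickening_iff.2 ⟨z - PiLp.single 2 k (z k - corner a k - n),
    ⟨_, setOf_apply_eq_mem_gridLines hn k, ?_⟩, ?_⟩
  · rw [mem_ofPred_eq, PiLp.sub_apply, PiLp.single_apply, if_pos rfl]
    ring
  · rwa [dist_eq_norm, sub_sub_cancel, PiLp.norm_single, Real.norm_eq_abs]

/-- The point with coordinates `w` relative to the lower left corner of the root square. -/
noncomputable def fromCorner (a : Fin L × Fin L) (w : Fin 2 → ℝ) : Plane :=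
  WithLp.toLp 2 (corner a + w)

lemma fromCorner_apply (a : Fin L × Fin L) (w : Fin 2 → ℝ) (k : Fin 2) :
    fromCorner a w k = corner a k + w k := rfl

lemma fromCorner_apply_eq_iff {w : Fin 2 → ℝ} : fromCorner a w k = corner a k + u ↔ w k = u :=
  add_right_inj _

lemma fromCorner_injective (a : Fin L × Fin L) : Function.Injective (fromCorner a) :=
  (WithLp.toLp_injective 2).comp (add_right_injective _)

lemma range_diff_eq_range_diff {α β : Type*} {f g : α → β} {U : Set β}
    (h : ∀ t, f t = g t ∨ f t ∈ U ∧ g t ∈ U) : range f \ U = range g \ U := by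
  have hsub : ∀ {f g : α → β}, (∀ t, f t = g t ∨ f t ∈ U ∧ g t ∈ U) →
      range f \ U ⊆ range g \ U := by
    rintro f g h - ⟨⟨t, rfl⟩, ht⟩
    have heq := (h t).resolve_right fun h' => ht h'.1
    exact ⟨⟨t, heq.symm⟩, ht⟩
  exact (hsub h).antisymm (hsub fun t => (h t).imp Eq.symm And.symm)

end Grid

section Portals

variable {b : Plane × Plane} {z : Plane} {k : Fin 2} {M j : ℕ} {u l r N δ v ε : ℝ}

lemma sum_eq_add_rev {α : Type*} [AddCommMonoid α] (k : Fin 2) (f : Fin 2 → α) :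
    ∑ j, f j = f k + f k.rev := by
  match k with
  | 0 => exact Fin.sum_univ_two f
  | 1 => exact (Fin.sum_univ_two f).trans (add_comm _ _)

lemma IsAxisSegment.dist_eq (h : IsAxisSegment b k u l r) (hlr : l ≤ r) :
    dist b.1 b.2 = r - l := by
  rw [EuclideanSpace.dist_eq, sum_eq_add_rev k, h.fst, h.snd, h.fst_rev, h.snd_rev, dist_self,
    Real.dist_eq, zero_pow two_ne_zero, zero_add, sq_abs, Real.sqrt_sq_eq_abs, abs_sub_comm,
    abs_of_nonneg (sub_nonneg.2 hlr)]

lemma IsAxisSegment.pointAt (h : IsAxisSegment b k u l r) (hlr : l < r) (s t : ℝ) :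
    IsAxisSegment (pointAt b s, pointAt b t) k u (l + s) (l + t) := by
  have happly : ∀ t j, PortalSnapping.pointAt b t j = b.1 j + t / (r - l) * (b.2 j - b.1 j) := by
    intro t j
    simp only [PortalSnapping.pointAt, h.dist_eq hlr.le, AffineMap.lineMap_apply, vsub_eq_sub,
      vadd_eq_add, PiLp.add_apply, PiLp.smul_apply, PiLp.sub_apply, smul_eq_mul]
    ring
  have hne : r - l ≠ 0 := (sub_pos.2 hlr).ne'
  constructor <;> simp only [happly, h.fst, h.snd, h.fst_rev, h.snd_rev, sub_self, mul_zero,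
    add_zero, div_mul_cancel₀ _ hne]

lemma IsAxisSegment.mem_portals (h : IsAxisSegment b k u l r) (hlr : l < r) (hδ : 0 ≤ δ)
    (hj : j ≤ M) (hz : z k = u)
    (hz' : z k.rev - l ∈ Icc (j * ((r - l - δ) / M)) (j * ((r - l - δ) / M) + δ)) :
    z ∈ portals b (M + 1) δ := by
  refine ⟨j, Nat.lt_succ_of_le hj, ?_⟩
  rw [h.dist_eq hlr.le, Nat.cast_add_one, add_sub_cancel_right]
  exact ((h.pointAt hlr _ _).mem_segment_iff (by linarith)).2
    ⟨hz, by linarith [hz'.1], by linarith [hz'.2]⟩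

lemma exists_portal_of_abs_sub_lt (hM : 0 < M) (hεδ : ε ≤ δ) (hεN : ε ≤ N) {c d : ℤ}
    (hv : v ∈ Icc (N * c) (N * (c + 1))) (hd : |v - N * d| < ε) :
    ∃ j : ℕ, j ≤ M ∧ v - N * c ∈ Icc (j * ((N - δ) / M)) (j * ((N - δ) / M) + δ) := by
  obtain ⟨hlow, hhigh⟩ := abs_lt.1 hd
  have hN : 0 < N := ((abs_nonneg _).trans_lt hd).trans_le hεN
  have hc : c < d + 1 := by
    have : (c : ℝ) < d + 1 := lt_of_mul_lt_mul_left (by linarith [hv.1]) hN.le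
    exact_mod_cast this
  have hd' : d < c + 2 := by
    have : (d : ℝ) < c + 2 := lt_of_mul_lt_mul_left (by linarith [hv.2]) hN.le
    exact_mod_cast this
  obtain rfl | rfl : d = c ∨ d = c + 1 := by omega
  · refine ⟨0, M.zero_le, ?_⟩
    rw [Nat.cast_zero, zero_mul, zero_add]
    exact ⟨by linarith [hv.1], by linarith⟩
  · refine ⟨M, le_rfl, ?_⟩
    push_cast at hlow
    rw [mul_div_cancel₀ _ (Nat.cast_ne_zero.2 hM.ne')]
    exact ⟨by linarith, by linarith [hv.2]⟩

end Portals

section Family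

/-- A family of segments between points near the lattice `{0, …, L}²`, together with the parameters
of the portals: every boundary carries `M + 1` of them, and they have length `θ`. -/
structure LatticeFamily (ι : Type*) (L : ℕ) where
  x : ι → Plane
  y : ι → Plane
  M : ℕ
  θ : ℝ
  isPowTwo : ∃ e : ℕ, L = 2 ^ e
  x_mem : ∀ i, x i ∈ Metric.thickening (1 / 4) (lattice L)
  y_mem : ∀ i, y i ∈ Metric.thickening (1 / 4) (lattice L)
  M_pos : 0 < M
  θ_pos : 0 < θ
  θ_mul_lt : θ * M < 1

namespace LatticeFamily

variable {ι : Type*} {L : ℕ} (F : LatticeFamily ι L) {a : Fin L × Fin L} {i : ι} {k : Fin 2}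
  {n : ℤ} {t ε δ : ℝ}

include F in
lemma one_le_boundaryLength (n : ℤ) : (1 : ℝ) ≤ boundaryLength L n := by
  obtain ⟨e, he⟩ := F.isPowTwo
  exact_mod_cast boundaryLength_pos (n := n) (he ▸ Nat.two_pow_pos e)

lemma θ_le_boundaryLength (n : ℤ) : F.θ ≤ boundaryLength L n := by
  have hM : (1 : ℝ) ≤ F.M := mod_cast F.M_pos
  exact ((le_mul_of_one_le_right F.θ_pos.le hM).trans F.θ_mul_lt.le).trans
    (F.one_le_boundaryLength n)

/-- The data for sliding the segments of the family into the portals of the dissection `D(a)`. -/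
noncomputable def snapData (a : Fin L × Fin L) : SnapData ι where
  start i k := F.x i k - corner a k
  finish i k := F.y i k - corner a k
  snap n := portalSnap (boundaryLength L n) F.M F.θ
  owns := OwnsCorner L
  lines := Finset.Ioo 0 (2 * L)
  start_far i := quarter_le_abs_sub_corner_sub (F.x_mem i) a
  finish_far i := quarter_le_abs_sub_corner_sub (F.y_mem i) a
  mem_lines i k n h := by
    obtain ⟨hx₀, hx₁⟩ := sub_corner_mem_Ioo (F.x_mem i) a k
    obtain ⟨hy₀, hy₁⟩ := sub_corner_mem_Ioo (F.y_mem i) a k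
    have h₀ : (0 : ℝ) < n := (lt_min hx₀ hy₀).trans h.1
    have h₁ : (n : ℝ) < 2 * L := h.2.trans (max_lt hx₁ hy₁)
    exact Finset.mem_Ioo.2 ⟨mod_cast h₀, mod_cast h₁⟩
  owns_rev k n z := ownsCorner_rev
  snap_strictMono n := portalSnap_strictMono F.M_pos F.θ_pos (F.θ_le_boundaryLength n)
  snap_ne n v z := portalSnap_ne_intCast (n := boundaryLength L n) F.M_pos F.θ_pos F.θ_mul_lt z
  owns_of_mem n k v z hz hne := ownsCorner_of_not_dvd F.isPowTwo fun ⟨c, hc⟩ => hne <| by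
    rw [hc] at hz ⊢
    push_cast at hz ⊢
    exact eq_of_mul_mem_uIcc_portalSnap F.M_pos F.θ_pos (F.θ_le_boundaryLength n) hz

lemma crosses_snapData_iff :
    (F.snapData a).Crosses i k n ↔ n - offset a k ∈ crossings (F.x i k) (F.y i k) := by
  rw [mem_crossings, SnapData.Crosses]
  simp only [snapData, uIoo, mem_Ioo, min_sub_sub_right, max_sub_sub_right, corner_eq]
  push_cast
  constructor <;> rintro ⟨h₀, h₁⟩ <;> constructor <;> linarith

lemma two_mul_abs_shift_snapData_le :
    2 * |(F.snapData a).shift i k n| ≤ boundaryLength L n / F.M + 2 * F.θ := by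
  have hM : (0 : ℝ) < F.M := mod_cast F.M_pos
  by_cases h : (F.snapData a).Active i k n
  · have hsnap := abs_portalSnap_sub_le (θ := F.θ) (v := (F.snapData a).pos i k n)
      (zero_lt_one.trans_le (F.one_le_boundaryLength n)) F.M_pos F.θ_pos.le
    rw [h.shift_eq]
    calc 2 * |(F.snapData a).snap n ((F.snapData a).pos i k n) - (F.snapData a).pos i k n|
        ≤ 2 * (boundaryLength L n / (2 * F.M) + F.θ) := by gcongr; exact hsnap
      _ = boundaryLength L n / F.M + 2 * F.θ := by field_simp
  · rw [SnapData.shift_of_not_active h, abs_zero, mul_zero]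
    have := F.θ_pos
    positivity

/-- A bound for the increase of the length of the `i`-th segment when it is slid into the portals
of `D(a)`. -/
noncomputable def slideCost (a : Fin L × Fin L) (i : ι) : ℝ :=
  ∑ k, ∑ P ∈ crossings (F.x i k) (F.y i k),
    ((boundaryLength L (P + offset a k) : ℝ) / F.M + 2 * F.θ)

lemma slideCost_nonneg (a : Fin L × Fin L) (i : ι) : 0 ≤ F.slideCost a i := by
  have := F.θ_pos
  unfold slideCost
  positivity

lemma sum_abs_shift_le_slideCost :
    ∑ k, ∑ n ∈ (F.snapData a).lines, 2 * |(F.snapData a).shift i k n| ≤ F.slideCost a i := by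
  classical
  refine Finset.sum_le_sum fun k _ => ?_
  have hcross : ∀ n, (F.snapData a).Crosses i k n ↔
      n ∈ (crossings (F.x i k) (F.y i k)).image (· + (offset a k : ℤ)) := fun n => by
    simp only [crosses_snapData_iff, Finset.mem_image, ← eq_sub_iff_add_eq, exists_eq_right]
  rw [← Finset.sum_subset fun n hn => ((hcross n).2 hn).mem_lines,
    Finset.sum_image (add_left_injective _).injOn]
  · exact Finset.sum_le_sum fun P _ => F.two_mul_abs_shift_snapData_le
  · intro n _ hn
    rw [SnapData.shift_of_not_active fun h => hn ((hcross n).1 h.1), abs_zero, mul_zero]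

lemma fromCorner_start : fromCorner a ((F.snapData a).start i) = F.x i := by
  ext k
  exact add_sub_cancel (corner a k) (F.x i k)

lemma fromCorner_finish : fromCorner a ((F.snapData a).finish i) = F.y i := by
  ext k
  exact add_sub_cancel (corner a k) (F.y i k)

lemma range_fromCorner_pt : range (fun t : unitInterval =>
    fromCorner a ((F.snapData a).pt i t)) = segment ℝ (F.x i) (F.y i) := by
  rw [segment_eq_image_lineMap, image_eq_range]
  congr 1
  ext t k
  simp only [fromCorner_apply, SnapData.pt, SnapData.dir, snapData, AffineMap.lineMap_apply,
    vsub_eq_sub, vadd_eq_add, PiLp.add_apply, PiLp.smul_apply, PiLp.sub_apply, smul_eq_mul]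
  ring

lemma norm_toLp_dir : ‖WithLp.toLp 2 ((F.snapData a).dir i)‖ = dist (F.x i) (F.y i) := by
  rw [dist_comm, dist_eq_norm]
  congr 1
  ext k
  exact sub_sub_sub_cancel_right _ _ _

section Path

variable [Fintype ι]

lemma exists_isFine (a : Fin L × Fin L) {δ' : ℝ} (hδ : 0 < δ) (hδ' : 0 < δ') :
    ∃ ε, (F.snapData a).IsFine ε ∧ ε ≤ δ ∧ ε ≤ δ' := by
  obtain ⟨ε, hε, hlt, hlt'⟩ := ((F.snapData a).eventually_isFine.and
    ((eventually_mul_lt 1 hδ).and (eventually_mul_lt 1 hδ'))).exists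
  rw [one_mul] at hlt hlt'
  exact ⟨ε, hε, hlt.le, hlt'.le⟩

/-- The `i`-th segment, slid into the portals of `D(a)`. -/
noncomputable def snappedPath (hε : (F.snapData a).IsFine ε) (i : ι) : Path (F.x i) (F.y i) where
  toFun t := fromCorner a ((F.snapData a).moved ε i t)
  continuous_toFun := (PiLp.continuous_toLp 2 _).comp <| continuous_const.add <|
    (SnapData.continuous_moved ε i).comp continuous_subtype_val
  source' := (congrArg _ (hε.moved_zero i)).trans F.fromCorner_start
  target' := (congrArg _ (hε.moved_one i)).trans F.fromCorner_finish

variable (hε : (F.snapData a).IsFine ε)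

include hε in
lemma fromCorner_moved_eq_or_mem_thickening (hεδ : ε ≤ δ) (i : ι) (t : ℝ) :
    fromCorner a ((F.snapData a).moved ε i t) = fromCorner a ((F.snapData a).pt i t) ∨
      fromCorner a ((F.snapData a).moved ε i t) ∈ Metric.thickening δ (gridUnion a) ∧
        fromCorner a ((F.snapData a).pt i t) ∈ Metric.thickening δ (gridUnion a) := by
  by_cases h : ∃ k n, (F.snapData a).Near ε i t k n
  · obtain ⟨k, n, h⟩ := h
    have hthick : ∀ w : Fin 2 → ℝ, |w k - n| < ε →
        fromCorner a w ∈ Metric.thickening δ (gridUnion a) := fun w hw =>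
      mem_thickening_gridUnion h.active.1.mem_lines (k := k)
        (by rw [fromCorner_apply, add_sub_cancel_left]; exact hw.trans_le hεδ)
    exact Or.inr ⟨hthick _ (h.abs_moved_sub_lt hε), hthick _ h.abs_lt⟩
  · push Not at h
    exact Or.inl (congrArg _ (SnapData.moved_eq_pt_of_not_near hε.pos h))

lemma range_snappedPath_diff_thickening (hεδ : ε ≤ δ) (i : ι) :
    range (F.snappedPath hε i) \ Metric.thickening δ (gridUnion a) =
      segment ℝ (F.x i) (F.y i) \ Metric.thickening δ (gridUnion a) := by
  rw [← F.range_fromCorner_pt (a := a)]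
  exact range_diff_eq_range_diff fun t => F.fromCorner_moved_eq_or_mem_thickening hε hεδ i t

include hε in
lemma moved_eq_pt_of_mem_endpoints
    (h : fromCorner a ((F.snapData a).pt i t) ∈ ({F.x i, F.y i} : Set Plane)) :
    (F.snapData a).moved ε i t = (F.snapData a).pt i t := by
  refine hε.moved_eq_pt_of_far ?_
  rcases h with h | h
  · rw [fromCorner_injective a (h.trans F.fromCorner_start.symm)]
    exact (F.snapData a).start_far i
  · rw [fromCorner_injective a (h.trans F.fromCorner_finish.symm)]
    exact (F.snapData a).finish_far i

lemma pairwise_disjoint_snappedPath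
    (h : Pairwise fun i j => Disjoint (segment ℝ (F.x i) (F.y i) \ {F.x i, F.y i})
      (segment ℝ (F.x j) (F.y j) \ {F.x j, F.y j})) :
    Pairwise fun i j => Disjoint (range (F.snappedPath hε i) \ {F.x i, F.y i})
      (range (F.snappedPath hε j) \ {F.x j, F.y j}) := by
  have hinterior : ∀ i (t : unitInterval), F.snappedPath hε i t ∉ ({F.x i, F.y i} : Set Plane) →
      fromCorner a ((F.snapData a).pt i t) ∈ segment ℝ (F.x i) (F.y i) \ {F.x i, F.y i} := by
    refine fun i t ht => ⟨F.range_fromCorner_pt (a := a) ▸ mem_range_self t, fun hend => ht ?_⟩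
    rw [← F.moved_eq_pt_of_mem_endpoints hε hend] at hend
    exact hend
  refine fun i j hij => disjoint_left.2 ?_
  rintro z ⟨⟨t, rfl⟩, ht⟩ ⟨⟨s, hs⟩, hs'⟩
  have hpt := hε.pt_eq_of_moved_eq t.2 s.2 (fromCorner_injective a hs.symm)
  rw [← hs] at hs'
  exact disjoint_left.1 (h hij) (hinterior i t ht) (hpt ▸ hinterior j s hs')

lemma range_snappedPath_inter_boundary_subset_portals (hεδ : ε ≤ δ) (hθδ : F.θ ≤ δ) (i : ι)
    {b : Plane × Plane} (hb : IsBoundary a b) :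
    range (F.snappedPath hε i) ∩ segment ℝ b.1 b.2 ⊆ portals b (F.M + 1) δ := by
  rintro z ⟨⟨t, rfl⟩, hz⟩
  obtain ⟨k, n, c, hseg⟩ := hb.exists_isAxisSegment F.isPowTwo
  set N : ℝ := (boundaryLength L n : ℝ)
  have hN : 1 ≤ N := F.one_le_boundaryLength n
  obtain ⟨hzk, hzrev⟩ := (hseg.mem_segment_iff (by linarith)).1 hz
  have hn := fromCorner_apply_eq_iff.1 hzk
  have hmem : (F.snapData a).moved ε i t k.rev ∈ Icc (N * c) (N * (c + 1)) :=
    ⟨le_of_add_le_add_left hzrev.1, le_of_add_le_add_left hzrev.2⟩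
  obtain ⟨j, hj, hportal⟩ : ∃ j : ℕ, j ≤ F.M ∧ (F.snapData a).moved ε i t k.rev - N * c ∈
      Icc (j * ((N - δ) / F.M)) (j * ((N - δ) / F.M) + δ) := by
    rcases hε.near_of_moved_eq_intCast t.2 hn with hnear | ⟨z, hnear⟩
    · rw [hnear.moved_rev_of_moved_eq hε hn] at hmem ⊢
      exact exists_portal_of_portalSnap_mem_Icc F.M_pos F.θ_pos (F.θ_le_boundaryLength n) hθδ hmem
    · obtain ⟨d, rfl⟩ := OwnsCorner.boundaryLength_dvd F.isPowTwo
        (hnear.owns_of_moved_rev_eq hε (by rwa [Fin.rev_rev]))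
      have hd := hnear.abs_moved_sub_lt hε
      push_cast at hd
      exact exists_portal_of_abs_sub_lt F.M_pos hεδ (by linarith [hε.lt]) hmem hd
  refine hseg.mem_portals (by linarith) (F.θ_pos.le.trans hθδ) hj hzk ?_
  have hlength : corner a k.rev + N * (c + 1) - (corner a k.rev + N * c) = N := by ring
  rw [hlength]
  change corner a k.rev + (F.snapData a).moved ε i t k.rev - (corner a k.rev + N * c) ∈ _
  rwa [add_sub_add_left_eq_sub]

lemma inter_gridLines_inter_range_snappedPath_eq_empty (i : ι) {g₁ g₂ : Set Plane}
    (h₁ : g₁ ∈ gridLines a) (h₂ : g₂ ∈ gridLines a) (hne : g₁ ≠ g₂) :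
    g₁ ∩ g₂ ∩ range (F.snappedPath hε i) = ∅ := by
  obtain ⟨k, n, -, rfl⟩ := mem_gridLines h₁
  obtain ⟨l, m, -, rfl⟩ := mem_gridLines h₂
  rw [eq_empty_iff_forall_notMem]
  rintro z ⟨⟨hz₁, hz₂⟩, t, rfl⟩
  rcases eq_or_eq_rev k l with rfl | rfl
  · refine hne ?_
    rw [← hz₁.symm.trans hz₂]
  · exact hε.moved_rev_ne_intCast t.2 (fromCorner_apply_eq_iff.1 hz₁) m
      (fromCorner_apply_eq_iff.1 hz₂)

lemma finite_iUnion_range_snappedPath_inter_gridUnion :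
    ((⋃ i, range (F.snappedPath hε i)) ∩ gridUnion a).Finite := by
  have hfin : (⋃ i, (fun t => fromCorner a ((F.snapData a).moved ε i t)) '' {t ∈ Icc (0 : ℝ) 1 |
      ∃ k, ∃ n ∈ Finset.Ioo (0 : ℤ) (2 * L), (F.snapData a).moved ε i t k = n}).Finite :=
    finite_iUnion fun i => (hε.finite_setOf_moved_eq_intCast i _).image _
  refine hfin.subset ?_
  rintro z ⟨hz, g, hg, hzg⟩
  obtain ⟨i, t, rfl⟩ := mem_iUnion.1 hz
  obtain ⟨k, n, hn, rfl⟩ := mem_gridLines hg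
  exact mem_iUnion.2 ⟨i, t, ⟨t.2, k, n, hn, fromCorner_apply_eq_iff.1 hzg⟩, rfl⟩

lemma curveLength_snappedPath_le (i : ι) : curveLength (F.snappedPath hε i) ≤
    ENNReal.ofReal (dist (F.x i) (F.y i) + F.slideCost a i) := by
  refine (SnapData.eVariationOn_moved_le hε.pos.le i (corner a)).trans
    (ENNReal.ofReal_le_ofReal ?_)
  rw [norm_toLp_dir]
  exact add_le_add le_rfl F.sum_abs_shift_le_slideCost

end Path

section Average

variable {e : ℕ}

lemma sum_boundaryLength_add_offset (he : L = 2 ^ e) (k : Fin 2) (P : ℤ) :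
    ∑ a : Fin L × Fin L, ((boundaryLength L (P + offset a k) : ℝ) / F.M + 2 * F.θ) =
      L ^ 2 * ((e + 2) / (2 * F.M) + 2 * F.θ) := by
  have hsum : ∑ b : Fin L, (boundaryLength L (P + b) : ℝ) = L * (e + 2) / 2 := by
    subst he
    push_cast
    linarith [two_mul_sum_boundaryLength_add e P]
  rw [sum_offset k fun b => (boundaryLength L (P + b) : ℝ) / F.M + 2 * F.θ,
    Finset.sum_add_distrib, ← Finset.sum_div, hsum, Finset.sum_const, Finset.card_univ,
    Fintype.card_fin, nsmul_eq_mul]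
  ring

lemma sum_slideCost_le (he : L = 2 ^ e) (i : ι) :
    ∑ a, F.slideCost a i ≤
      L ^ 2 * ((e + 2) / (2 * F.M) + 2 * F.θ) * (2 * √2 * dist (F.x i) (F.y i)) := by
  have hcard : ∀ k, ((crossings (F.x i k) (F.y i k)).card : ℝ) ≤ 2 * |(F.y i - F.x i) k| := by
    intro k
    obtain ⟨p, -, hp⟩ := exists_natCast_abs_sub_lt (F.x_mem i) k
    obtain ⟨q, -, hq⟩ := exists_natCast_abs_sub_lt (F.y_mem i) k
    exact card_crossings_le (i := p) (j := q) hp hq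
  have hθ := F.θ_pos
  calc ∑ a, F.slideCost a i
      = ∑ k, ∑ P ∈ crossings (F.x i k) (F.y i k), ∑ a : Fin L × Fin L,
          ((boundaryLength L (P + offset a k) : ℝ) / F.M + 2 * F.θ) := by
        simp only [slideCost]
        rw [Finset.sum_comm]
        exact Finset.sum_congr rfl fun k _ => Finset.sum_comm
    _ = L ^ 2 * ((e + 2) / (2 * F.M) + 2 * F.θ) *
          ∑ k, ((crossings (F.x i k) (F.y i k)).card : ℝ) := by
        simp only [F.sum_boundaryLength_add_offset he, Finset.sum_const, nsmul_eq_mul]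
        rw [← Finset.sum_mul, mul_comm]
    _ ≤ L ^ 2 * ((e + 2) / (2 * F.M) + 2 * F.θ) * (2 * (√2 * ‖F.y i - F.x i‖)) := by
        gcongr
        calc ∑ k, ((crossings (F.x i k) (F.y i k)).card : ℝ)
            ≤ 2 * ∑ k, |(F.y i - F.x i) k| := by
              rw [Finset.mul_sum]
              exact Finset.sum_le_sum fun k _ => hcard k
          _ ≤ 2 * (√2 * ‖F.y i - F.x i‖) := by
              gcongr
              simpa only [Fintype.card_fin, Nat.cast_ofNat] using
                sum_abs_le_sqrt_card_mul_norm (F.y i - F.x i)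
    _ = L ^ 2 * ((e + 2) / (2 * F.M) + 2 * F.θ) * (2 * √2 * dist (F.x i) (F.y i)) := by
        rw [dist_comm, dist_eq_norm, mul_assoc 2]

lemma average_curveLength_snappedPath_sub_le [Fintype ι] (he : L = 2 ^ e)
    {ε : Fin L × Fin L → ℝ} (hε : ∀ a, (F.snapData a).IsFine (ε a)) :
    (∑ a, ((∑ i, (curveLength (F.snappedPath (hε a) i)).toReal) - ∑ i, dist (F.x i) (F.y i))) /
        (L : ℝ) ^ 2 ≤
      ((e + 2) / (2 * F.M) + 2 * F.θ) * (2 * √2 * ∑ i, dist (F.x i) (F.y i)) := by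
  have hL : (0 : ℝ) < L := mod_cast he ▸ Nat.two_pow_pos e
  have hexcess : ∀ a, (∑ i, (curveLength (F.snappedPath (hε a) i)).toReal) -
      ∑ i, dist (F.x i) (F.y i) ≤ ∑ i, F.slideCost a i := fun a => by
    rw [← Finset.sum_sub_distrib]
    exact Finset.sum_le_sum fun i _ => sub_le_iff_le_add'.2 <| ENNReal.toReal_le_of_le_ofReal
      (add_nonneg dist_nonneg (F.slideCost_nonneg a i)) (F.curveLength_snappedPath_le (hε a) i)
  rw [div_le_iff₀ (by positivity)]
  calc ∑ a, ((∑ i, (curveLength (F.snappedPath (hε a) i)).toReal) - ∑ i, dist (F.x i) (F.y i))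
      ≤ ∑ a, ∑ i, F.slideCost a i := Finset.sum_le_sum fun a _ => hexcess a
    _ = ∑ i, ∑ a, F.slideCost a i := Finset.sum_comm
    _ ≤ ∑ i, L ^ 2 * ((e + 2) / (2 * F.M) + 2 * F.θ) * (2 * √2 * dist (F.x i) (F.y i)) :=
        Finset.sum_le_sum fun i _ => F.sum_slideCost_le he i
    _ = ((e + 2) / (2 * F.M) + 2 * F.θ) * (2 * √2 * ∑ i, dist (F.x i) (F.y i)) * L ^ 2 := by
        rw [← Finset.mul_sum, ← Finset.mul_sum]
        ring

end Average

end LatticeFamily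

end Family

lemma slide_factor_le {r e M : ℕ} {δ : ℝ} (hM : r * e = M + 1) (he : 2 ≤ e) (hδ : δ ≤ 1) :
    (((e : ℝ) + 2) / (2 * M) + 2 * (δ / (2 * M))) * (2 * r) ≤ 7 := by
  have hr : 0 < r := Nat.pos_of_mul_pos_right (by omega : 0 < r * e)
  have hrM : 2 * r ≤ M + 1 := hM ▸ mul_comm r e ▸ Nat.mul_le_mul_right r he
  have hM₁ : (1 : ℝ) ≤ M := mod_cast (by omega : 1 ≤ M)
  calc (((e : ℝ) + 2) / (2 * M) + 2 * (δ / (2 * M))) * (2 * r)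
      = (r * e + 2 * r + 2 * (δ * r)) / M := by field_simp
    _ ≤ ((M + 1) + (M + 1) + 1 * (M + 1)) / M := by
        gcongr ?_ / _
        have hrM' : 2 * (r : ℝ) ≤ M + 1 := mod_cast hrM
        have hre : (r : ℝ) * e = M + 1 := mod_cast hM
        linarith [mul_le_of_le_one_left (r.cast_nonneg (α := ℝ)) hδ]
    _ ≤ 7 := by
        rw [div_le_iff₀ (zero_lt_one.trans_le hM₁)]
        linarith

lemma slide_factor_mul_le {r e M : ℕ} {δ d : ℝ} (hM : r * e = M + 1) (he : 2 ≤ e) (hδ : δ ≤ 1)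
    (hd : 0 ≤ d) :
    (((e : ℝ) + 2) / (2 * M) + 2 * (δ / (2 * M))) * (2 * √2 * d) ≤ 7 * √2 * (d / r) := by
  have hr : 0 < r := Nat.pos_of_mul_pos_right (by omega : 0 < r * e)
  calc (((e : ℝ) + 2) / (2 * M) + 2 * (δ / (2 * M))) * (2 * √2 * d)
      = (((e : ℝ) + 2) / (2 * M) + 2 * (δ / (2 * M))) * (2 * r) * (√2 * (d / r)) := by field_simp
    _ ≤ 7 * (√2 * (d / r)) := by
        gcongr
        exact slide_factor_le hM he hδ
    _ = 7 * √2 * (d / r) := (mul_assoc _ _ _).symm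

end PortalSnapping

theorem mainTheorem6 (L : ℕ) (hLpow : ∃ n : ℕ, L = 2 ^ n) (hL : 4 ≤ L)
    (m : ℕ) (x y : Fin m → Plane)
    (hx : ∀ i, x i ∈ Metric.thickening (1 / 4) (lattice L))
    (hy : ∀ i, y i ∈ Metric.thickening (1 / 4) (lattice L))
    (r : ℕ) (hr : r ≠ 0) (δ : ℝ) (hδ : δ ∈ Set.Ioo (0 : ℝ) 1) (δ' : ℝ) (hδ' : 0 < δ') :
    ∃ s' : Fin L × Fin L → (i : Fin m) → Path (x i) (y i),
      (∀ a : Fin L × Fin L,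
        -- a) the curves differ from the segments only near the grid lines
        (∀ i, Set.range (s' a i) \ Metric.thickening δ' (gridUnion a) =
          segment ℝ (x i) (y i) \ Metric.thickening δ' (gridUnion a)) ∧
        -- b) disjointness of the interiors is preserved
        ((Pairwise fun i j => Disjoint (segment ℝ (x i) (y i) \ {x i, y i})
            (segment ℝ (x j) (y j) \ {x j, y j})) →
          Pairwise fun i j => Disjoint (Set.range (s' a i) \ {x i, y i})
            (Set.range (s' a j) \ {x j, y j})) ∧
        -- c) boundaries are met only in their portals
        (∀ i, ∀ b : Plane × Plane, IsBoundary a b →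
          Set.range (s' a i) ∩ segment ℝ b.1 b.2 ⊆ portals b (r * Nat.log 2 L) δ) ∧
        -- d) no intersection point of two grid lines is met
        (∀ i, ∀ g₁ ∈ gridLines a, ∀ g₂ ∈ gridLines a, g₁ ≠ g₂ →
          g₁ ∩ g₂ ∩ Set.range (s' a i) = ∅) ∧
        -- e) the grid lines are met in finitely many points
        ((⋃ i, Set.range (s' a i)) ∩ gridUnion a).Finite ∧
        -- the curves have finite length
        (∀ i, curveLength (s' a i) ≠ ⊤)) ∧
      -- f) the expected increase of the total length, for uniformly random `a`
      (∑ a : Fin L × Fin L,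
          ((∑ i, (curveLength (s' a i)).toReal) - ∑ i, dist (x i) (y i))) / (L : ℝ) ^ 2 ≤
        7 * Real.sqrt 2 * ((∑ i, dist (x i) (y i)) / r) := by
  obtain ⟨e, he⟩ := id hLpow
  have hlog : Nat.log 2 L = e := he ▸ Nat.log_pow one_lt_two e
  have he₂ : 2 ≤ e := (Nat.pow_le_pow_iff_right one_lt_two).1 (he ▸ hL)
  obtain ⟨M, hM⟩ : ∃ M, r * e = M + 1 :=
    Nat.exists_eq_succ_of_ne_zero (mul_ne_zero hr (by omega))
  have hM₁ : 1 ≤ M := by nlinarith [Nat.pos_of_ne_zero hr]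
  have hM₁' : (1 : ℝ) ≤ M := mod_cast hM₁
  have hθM : δ / (2 * M) * M < 1 := by
    field_simp
    linarith [hδ.2]
  let F : LatticeFamily (Fin m) L :=
    ⟨x, y, M, δ / (2 * M), hLpow, hx, hy, hM₁, div_pos hδ.1 (by positivity), hθM⟩
  have hθδ : F.θ ≤ δ := div_le_self hδ.1.le (by linarith)
  choose ε hε hεδ hεδ' using fun a => F.exists_isFine a hδ.1 hδ'
  refine ⟨fun a i => F.snappedPath (hε a) i, fun a =>
    ⟨F.range_snappedPath_diff_thickening (hε a) (hεδ' a),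
      F.pairwise_disjoint_snappedPath (hε a),
      fun i b hb => ?_,
      fun i _ h₁ _ h₂ => F.inter_gridLines_inter_range_snappedPath_eq_empty (hε a) i h₁ h₂,
      F.finite_iUnion_range_snappedPath_inter_gridUnion (hε a),
      fun i => ne_top_of_le_ne_top ENNReal.ofReal_ne_top (F.curveLength_snappedPath_le (hε a) i)⟩,
    (F.average_curveLength_snappedPath_sub_le he hε).trans <|
      slide_factor_mul_le hM he₂ hδ.2.le (Finset.sum_nonneg fun i _ => dist_nonneg)⟩
  rw [hlog, hM]
  exact F.range_snappedPath_inter_boundary_subset_portals (hε a) (hεδ a) hθδ i hb
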